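/- Let $\mathrm E=\{(0)\}\cup\{(ij):1\le i<j\le 5\}\cup\{(k):1\le k\le 5\}$ index the weights of the $16$-dimensional spinor representation of $\mathrm{Spin}(10)$, and let $\hat{\mathrm E}=\mathrm E\times\mathbb Z$, with $(\alpha,r)$ written $\alpha^r$. Make $\hat{\mathrm E}$ a directed graph with the following arrows for every $r\in\mathbb Z$: $$(0)^r\to(12)^r\to(13)^r,\quad (13)^r\to(23)^r,(14)^r,\quad (23)^r\to(24)^r,\quad (14)^r\to(24)^r,(15)^r,\quad (24)^r\to(34)^r,(25)^r,$$ $$(34)^r\to(5)^r,(35)^r,\quad (5)^r\to(4)^r,\quad (15)^r\to(25)^r\to(35)^r,\quad (35)^r\to(4)^r,(45)^r,\quad (4)^r\to(3)^r,\quad (45)^r\to(3)^r\to(2)^r\to(1)^r,$$ $$(45)^r\to(0)^{r+1},\quad (3)^r\to(12)^{r+1},\quad (2)^r\to(13)^{r+1},\quad (1)^r\to(23)^{r+1}.$$ Order $\hat{\mathrm E}$ partially by $\hat\alpha\le\hat\beta$ if and only if there is a directed path (possibly of length $0$) from $\hat\alpha$ to $\hat\beta$. All segments $[\hat\delta,\hat\delta']=\{\hat\alpha:\hat\delta\le\hat\alpha\le\hat\delta'\}$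 are finite. Write $\lambda=\lambda^{(0)}$, $w_{ij}=\lambda^{(ij)}$, $p_k=\lambda^{(k)}$, and consider the ten quadrics that cut out the cone of pure spinors, $$\begin{aligned} \Gamma^{1}&=\lambda p_1+w_{25}w_{34}-w_{24}w_{35}+w_{23}w_{45}, & \Gamma^{1^*}&=-p_2w_{12}+p_3w_{13}-p_4w_{14}+p_5w_{15},\\ \Gamma^{2}&=-\lambda p_2-w_{15}w_{34}+w_{14}w_{35}-w_{13}w_{45}, & \Gamma^{2^*}&=-p_1w_{12}+p_3w_{23}-p_4w_{24}+p_5w_{25},\\ \Gamma^{3}&=\lambda p_3+w_{15}w_{24}-w_{14}w_{25}+w_{12}w_{45}, & \Gamma^{3^*}&=-p_1w_{13}+p_2w_{23}-p_4w_{34}+p_5w_{35},\\ \Gamma^{4}&=-\lambda p_4-w_{15}w_{23}+w_{13}w_{25}-w_{12}w_{35}, & \Gamma^{4^*}&=-p_1w_{14}+p_2w_{24}-p_3w_{34}+p_5w_{45},\\ \Gamma^{5}&=\lambda p_5+w_{14}w_{23}-w_{13}w_{24}+w_{12}w_{34}, & \Gamma^{5^*}&=-p_1w_{15}+p_2w_{25}-p_3w_{35}+p_4w_{45}.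 \end{aligned}$$ For $\hat\delta\le\hat\delta'$ in $\hat{\mathrm E}$ let $A_{\hat\delta}^{\hat\delta'}$ (the algebra of a semi-infinite Richardson variety of quantum $\mathrm{OGr}^+(5,10)$) be the quotient of the polynomial algebra $\mathbb C[\lambda^{\hat\alpha}:\hat\alpha\in[\hat\delta,\hat\delta']]$ by the ideal generated by all coefficients of powers of $z$ in the ten Laurent polynomials obtained from $\Gamma^1,\dots,\Gamma^5,\Gamma^{1^*},\dots,\Gamma^{5^*}$ by substituting, for each $\alpha\in\mathrm E$, $$\lambda^{\alpha}\;\longmapsto\;\lambda^\alpha(z)=\sum_{l\in\mathbb Z,\ \alpha^l\in[\hat\delta,\hat\delta']}\lambda^{\alpha^l}z^l .$$ Then for all $\hat\delta\le\hat\delta'$ in $\hat{\mathrm E}$ the algebra $A_{\hat\delta}^{\hat\delta'}$ is Cohen–Macaulay: it is Noetherian, and for every maximal ideal $\mathfrak m$ the depth of the local ring $(A_{\hat\delta}^{\hat\delta'})_{\mathfrak m}$ equals its Krull dimension. -/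

import Mathlib

namespace QuantumOGr

/-- The sixteen weights of the spinor representation of `Spin(10)`: `lam` is the weight `(0)`,
`wij` (with `i < j`) is the weight `(ij)`, and `pk` is the weight `(k)`. -/
inductive E : Type
  | lam
  | w12 | w13 | w14 | w15 | w23 | w24 | w25 | w34 | w35 | w45
  | p1 | p2 | p3 | p4 | p5

/-- The ten weights `1, …, 5, 1*, …, 5*` of the vector representation. -/
inductive G : Type
  | v1 | v2 | v3 | v4 | v5
  | v1s | v2s | v3s | v4s | v5s

/-- The vertices `α^r = (α, r)` of the affine diagram, `α` a spinor weight and `r` an integer. -/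
@[ext]
structure EHat : Type where
  weight : E
  mode : ℤ

open E in
/-- The arrows of the affine Hasse diagram: in each copy `E_r` the twenty arrows of the Hasse
diagram of the spinor weights, and four arrows from `E_r` to `E_{r+1}`. -/
inductive Arrow : EHat → EHat → Prop
  | a1 (r : ℤ) : Arrow ⟨lam, r⟩ ⟨w12, r⟩
  | a2 (r : ℤ) : Arrow ⟨w12, r⟩ ⟨w13, r⟩
  | a3 (r : ℤ) : Arrow ⟨w13, r⟩ ⟨w23, r⟩
  | a4 (r : ℤ) : Arrow ⟨w13, r⟩ ⟨w14, r⟩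
  | a5 (r : ℤ) : Arrow ⟨w23, r⟩ ⟨w24, r⟩
  | a6 (r : ℤ) : Arrow ⟨w14, r⟩ ⟨w24, r⟩
  | a7 (r : ℤ) : Arrow ⟨w14, r⟩ ⟨w15, r⟩
  | a8 (r : ℤ) : Arrow ⟨w24, r⟩ ⟨w34, r⟩
  | a9 (r : ℤ) : Arrow ⟨w24, r⟩ ⟨w25, r⟩
  | a10 (r : ℤ) : Arrow ⟨w34, r⟩ ⟨p5, r⟩
  | a11 (r : ℤ) : Arrow ⟨w34, r⟩ ⟨w35, r⟩
  | a12 (r : ℤ) : Arrow ⟨p5, r⟩ ⟨p4, r⟩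
  | a13 (r : ℤ) : Arrow ⟨w15, r⟩ ⟨w25, r⟩
  | a14 (r : ℤ) : Arrow ⟨w25, r⟩ ⟨w35, r⟩
  | a15 (r : ℤ) : Arrow ⟨w35, r⟩ ⟨p4, r⟩
  | a16 (r : ℤ) : Arrow ⟨w35, r⟩ ⟨w45, r⟩
  | a17 (r : ℤ) : Arrow ⟨p4, r⟩ ⟨p3, r⟩
  | a18 (r : ℤ) : Arrow ⟨w45, r⟩ ⟨p3, r⟩
  | a19 (r : ℤ) : Arrow ⟨p3, r⟩ ⟨p2, r⟩
  | a20 (r : ℤ) : Arrow ⟨p2, r⟩ ⟨p1, r⟩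
  | b1 (r : ℤ) : Arrow ⟨w45, r⟩ ⟨lam, r + 1⟩
  | b2 (r : ℤ) : Arrow ⟨p3, r⟩ ⟨w12, r + 1⟩
  | b3 (r : ℤ) : Arrow ⟨p2, r⟩ ⟨w13, r + 1⟩
  | b4 (r : ℤ) : Arrow ⟨p1, r⟩ ⟨w23, r + 1⟩

/-- The height of a spinor weight in the finite Hasse diagram. -/
def E.ht : E → ℤ
  | .lam => 0
  | .w12 => 1
  | .w13 => 2
  | .w14 => 3
  | .w23 => 3
  | .w15 => 4
  | .w24 => 4
  | .w25 => 5
  | .w34 => 5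
  | .w35 => 6
  | .p5 => 6
  | .w45 => 7
  | .p4 => 7
  | .p3 => 8
  | .p2 => 9
  | .p1 => 10

/-- The height on the affine diagram; every arrow raises it by one. -/
def EHat.ht (a : EHat) : ℤ := a.weight.ht + 8 * a.mode

theorem Arrow.ht_eq {a b : EHat} (h : Arrow a b) : b.ht = a.ht + 1 := by
  cases h <;> simp only [EHat.ht, E.ht] <;> ring

theorem path_ht {a b : EHat} (h : Relation.ReflTransGen Arrow a b) : a = b ∨ a.ht < b.ht := by
  induction h with
  | refl => exact Or.inl rfl
  | tail _ hbc ih =>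
    have := hbc.ht_eq
    rcases ih with rfl | ih
    · right; omega
    · right; omega

/-- The partial order on the affine diagram: `a ≤ b` when a directed path leads from `a` to `b`. -/
instance : PartialOrder EHat where
  le a b := Relation.ReflTransGen Arrow a b
  le_refl _ := Relation.ReflTransGen.refl
  le_trans _ _ _ h h' := h.trans h'
  le_antisymm a b h h' := by
    rcases path_ht h with rfl | h1
    · rfl
    · rcases path_ht h' with rfl | h2
      · rfl
      · omega

theorem ht_le {a b : EHat} (h : a ≤ b) : a.ht ≤ b.ht := by
  rcases path_ht h with rfl | h
  · exact le_rfl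
  · exact h.le

instance : Finite E := by
  refine Finite.of_injective (fun a : E => (⟨a.ctorIdx, by cases a <;> decide⟩ : Fin 16)) ?_
  intro a b h
  cases a <;> cases b <;> first | rfl | (exact absurd h (by decide))

theorem finite_Icc (d d' : EHat) : (Set.Icc d d').Finite := by
  refine Set.Finite.subset
    (((Set.finite_univ (α := E)).prod (Set.finite_Icc (d.mode - 3) (d'.mode + 3))).image
      (fun x => (⟨x.1, x.2⟩ : EHat))) ?_
  rintro ⟨a, r⟩ ⟨h1, h2⟩
  refine ⟨(a, r), ⟨Set.mem_univ _, ?_⟩, rfl⟩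
  have h1 := ht_le h1
  have h2 := ht_le h2
  have hb : ∀ e : E, 0 ≤ e.ht ∧ e.ht ≤ 10 := by intro e; cases e <;> simp [E.ht]
  have := hb a
  have := hb d.weight
  have := hb d'.weight
  simp only [EHat.ht] at h1 h2
  constructor <;> simp only <;> omega

/-- Segments of the affine diagram are finite. -/
noncomputable instance : LocallyFiniteOrder EHat := LocallyFiniteOrder.ofFiniteIcc finite_Icc

open E in
/-- The ten quadrics `Γ^s = ∑ Γ^s_{αβ} λ^α λ^β` that cut out the cone of pure spinors, evaluated
at a family `x` of elements of a commutative ring indexed by the spinor weights. -/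
def Gam {R : Type*} [CommRing R] (x : E → R) : G → R
  | .v1 => x lam * x p1 + x w25 * x w34 - x w24 * x w35 + x w23 * x w45
  | .v2 => -(x lam * x p2) - x w15 * x w34 + x w14 * x w35 - x w13 * x w45
  | .v3 => x lam * x p3 + x w15 * x w24 - x w14 * x w25 + x w12 * x w45
  | .v4 => -(x lam * x p4) - x w15 * x w23 + x w13 * x w25 - x w12 * x w35
  | .v5 => x lam * x p5 + x w14 * x w23 - x w13 * x w24 + x w12 * x w34
  | .v1s => -(x p2 * x w12) + x p3 * x w13 - x p4 * x w14 + x p5 * x w15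
  | .v2s => -(x p1 * x w12) + x p3 * x w23 - x p4 * x w24 + x p5 * x w25
  | .v3s => -(x p1 * x w13) + x p2 * x w23 - x p4 * x w34 + x p5 * x w35
  | .v4s => -(x p1 * x w14) + x p2 * x w24 - x p3 * x w34 + x p5 * x w45
  | .v5s => -(x p1 * x w15) + x p2 * x w25 - x p3 * x w35 + x p4 * x w45

/-- The polynomial algebra `ℂ[λ^a]`, with one generator for each `a` in the segment `[d, d']`. -/
abbrev Poly (d d' : EHat) : Type := MvPolynomial (Set.Icc d d') ℂ

open Classical in
/-- The generating function `λ^α(z) = ∑ λ^{α^l} z^l`, the sum over the `l` with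
`α^l ∈ [d, d']`. -/
noncomputable def genFun (d d' : EHat) (α : E) : LaurentPolynomial (Poly d d') :=
  ∑ a : Set.Icc d d',
    if a.1.weight = α then
      LaurentPolynomial.C (MvPolynomial.X a) * LaurentPolynomial.T a.1.mode
    else 0

/-- The quadric `Γ^{s^n}`: the coefficient of `z^n` in `Γ^s(λ(z))`. -/
noncomputable def relation (d d' : EHat) (s : G) (n : ℤ) : Poly d d' :=
  (Gam (genFun d d') s).coeff n

/-- The ideal of relations, generated by all the coefficients `Γ^{s^n}`. -/
noncomputable def relIdeal (d d' : EHat) : Ideal (Poly d d') :=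
  Ideal.span {f | ∃ (s : G) (n : ℤ), f = relation d d' s n}

/-- The algebra `A_d^{d'}` of the semi-infinite Richardson variety of the segment `[d, d']`. -/
abbrev RichardsonAlgebra (d d' : EHat) : Type := Poly d d' ⧸ relIdeal d d'

/-- The depth of a local ring: the supremum of the lengths of regular sequences in its maximal
ideal. -/
noncomputable def localDepth (R : Type*) [CommRing R] [IsLocalRing R] : ℕ∞ :=
  ⨆ rs : {rs : List R //
      (∀ r ∈ rs, r ∈ IsLocalRing.maximalIdeal R) ∧ RingTheory.Sequence.IsRegular R rs},
    (rs.1.length : ℕ∞)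

/-- A Cohen–Macaulay local ring: Noetherian, with depth equal to Krull dimension. -/
structure IsCohenMacaulayLocal (R : Type*) [CommRing R] [IsLocalRing R] : Prop where
  noetherian : IsNoetherianRing R
  depth_eq_dim : (localDepth R : WithBot ℕ∞) = ringKrullDim R

/-- A Cohen–Macaulay ring: Noetherian, with Cohen–Macaulay localization at every maximal ideal. -/
structure IsCohenMacaulay (R : Type*) [CommRing R] : Prop where
  noetherian : IsNoetherianRing R
  localization (m : Ideal R) [m.IsMaximal] : IsCohenMacaulayLocal (Localization.AtPrime m)

end QuantumOGr

/-! Sending α^r to a point (x, y) of ℤ² as in `EHat.coord` turns the order into the componentwise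
one. The image is a strip 0 ≤ x - y ≤ 4 with alternate points of both edges removed; a segment is
the part of it in a rectangle, and each height x + y belongs to exactly two vertices of the whole
diagram.

All products occurring in Γ^{s^n} have the same coordinate sum. Exactly one of them is a product of
incomparable vertices; in each other product one factor lies below both members of that pair and the
other above both. Every incomparable pair arises in this way from exactly one Γ^{s^n}. If λ^a has
weight ht(a)², convexity of the square makes the incomparable product the unique term of least
weight. Linear syzygies of the ten quadrics, one for each spinor weight, resolve the overlaps of
these leading terms (`exists_overlap`, `isResolving_rel`). A Buchberger argument
(`IsResolving.coeff_eq_zero`) then shows that the lowest-weight part of an element of the ideal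
involves no standard monomial, that is, no monomial supported on a chain.

Let θ_i be the sum of the one or two generators of level i. Over ℂ[θ] two families indexed by the
same finite set of admissible chains C are compared. The products u_C of the elements of C span the
algebra (`monomial_mem`). The products v_C over the leftmost maximal chain through C are independent
(`eq_zero_of_sum_mem_relIdeal`): modulo incomparable products θ^k v_C is the monomial with exponents
k_i + 1 along that chain, and the chain determines C (`IsAdmissible.ext`). A surjection and an
injection from one finite free module to the algebra make the surjection bijective. So the algebra
is finite free over a polynomial ring, hence Cohen–Macaulay (`isCohenMacaulay_of_free`). -/

namespace QuantumOGr

/-! ### Cohen–Macaulayness of finite free algebras over a polynomial ring -/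

section

open RingTheory.Sequence in
theorem localDepth_le_ringKrullDim (R : Type*) [CommRing R] [IsLocalRing R] [IsNoetherianRing R] :
    (localDepth R : WithBot ℕ∞) ≤ ringKrullDim R := by
  obtain ⟨n, hn⟩ : ∃ n : ℕ∞, ringKrullDim R = n :=
    ⟨_, (WithBot.coe_unbot _ (ringKrullDim_ne_bot (R := R))).symm⟩
  rw [hn, WithBot.coe_le_coe]
  refine iSup_le fun rs => ?_
  have h := ringKrullDim_add_length_eq_ringKrullDim_of_isRegular rs.1 rs.2.2
  have hne : Nontrivial (R ⧸ Ideal.ofList rs.1) := by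
    refine Ideal.Quotient.nontrivial_iff.mpr fun htop => ?_
    have : Ideal.ofList rs.1 ≤ IsLocalRing.maximalIdeal R := Ideal.span_le.mpr rs.2.1
    exact (IsLocalRing.maximalIdeal.isMaximal R).ne_top (top_le_iff.mp (htop ▸ this))
  have h0 : (0 : WithBot ℕ∞) ≤ ringKrullDim (R ⧸ Ideal.ofList rs.1) :=
    ringKrullDim_nonneg_of_nontrivial
  rw [hn] at h
  have : ((rs.1.length : ℕ∞) : WithBot ℕ∞) ≤ n := by
    rw [← h]
    exact le_add_of_nonneg_left h0
  exact_mod_cast this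

theorem le_localDepth {R : Type*} [CommRing R] [IsLocalRing R] (rs : List R)
    (h : ∀ r ∈ rs, r ∈ IsLocalRing.maximalIdeal R) (h' : RingTheory.Sequence.IsRegular R rs) :
    (rs.length : ℕ∞) ≤ localDepth R :=
  le_iSup (fun rs : {rs : List R //
      (∀ r ∈ rs, r ∈ IsLocalRing.maximalIdeal R) ∧ RingTheory.Sequence.IsRegular R rs} =>
    (rs.1.length : ℕ∞)) ⟨rs, h, h'⟩

open MvPolynomial in
/-- The partial evaluation substituting `c i` for the variables `X i` with `p i`. -/
noncomputable def partialEval {n : ℕ} (c : Fin n → ℂ) (p : Fin n → Prop) [DecidablePred p] :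
    MvPolynomial (Fin n) ℂ →ₐ[ℂ] MvPolynomial (Fin n) ℂ :=
  aeval fun i => if p i then C (c i) else X i

open MvPolynomial in
theorem ker_partialEval {n : ℕ} (c : Fin n → ℂ) (p : Fin n → Prop) [DecidablePred p] :
    RingHom.ker (partialEval c p) =
      Ideal.span ((fun i => X i - C (c i)) '' {i | p i}) := by
  apply le_antisymm
  · intro f hf
    have key : ∀ f, f - partialEval c p f ∈ Ideal.span ((fun i => X i - C (c i)) '' {i | p i}) := by
      intro f
      rw [← Ideal.Quotient.eq]
      have : (Ideal.Quotient.mkₐ ℂ (Ideal.span ((fun i => X i - C (c i)) '' {i | p i}))) =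
        (Ideal.Quotient.mkₐ ℂ _).comp (partialEval c p) := by
        ext i
        simp only [Ideal.Quotient.mkₐ_eq_mk, AlgHom.comp_apply, partialEval, aeval_X]
        split_ifs with h
        · exact Ideal.Quotient.eq.mpr (Ideal.subset_span ⟨i, h, rfl⟩)
        · rfl
      exact DFunLike.congr_fun this f
    simpa [(RingHom.mem_ker).mp hf] using key f
  · rw [Ideal.span_le]
    rintro _ ⟨i, hi, rfl⟩
    have hi' : p i := hi
    simp [partialEval, hi']

-- The first i elements generate the kernel of a partial evaluation into a domain. The next one is
-- fixed by that evaluation and nonzero, hence regular modulo the kernel.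
open MvPolynomial RingTheory.Sequence in
theorem isWeaklyRegular_X_sub_C {n : ℕ} (c : Fin n → ℂ) :
    IsWeaklyRegular (MvPolynomial (Fin n) ℂ) (List.ofFn fun i => X i - C (c i)) := by
  rw [isWeaklyRegular_iff_Fin]
  intro i
  have hi : (i : ℕ) < n := by simpa using i.2
  have hI : (Ideal.ofList ((List.ofFn fun i => (X i - C (c i) : MvPolynomial (Fin n) ℂ)).take i) •
      ⊤ : Submodule (MvPolynomial (Fin n) ℂ) (MvPolynomial (Fin n) ℂ)) =
      RingHom.ker (partialEval c fun j => (j : ℕ) < i) := by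
    rw [ker_partialEval, smul_eq_mul, Ideal.mul_top, Ideal.ofList]
    congr 1
    ext f
    simp only [Set.mem_ofPred_eq, Set.mem_image, List.mem_take_iff_getElem, List.getElem_ofFn,
      List.length_ofFn]
    constructor
    · rintro ⟨j, hj, rfl⟩
      exact ⟨⟨j, by omega⟩, by simp only; omega, rfl⟩
    · rintro ⟨j, hj, rfl⟩
      exact ⟨j, by omega, rfl⟩
  rw [hI, isSMulRegular_quotient_iff_mem_of_smul_mem]
  intro f hf
  rw [RingHom.mem_ker] at hf ⊢
  simp only [Fin.getElem_fin, List.getElem_ofFn, smul_eq_mul, map_mul, mul_eq_zero] at hf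
  refine hf.resolve_left ?_
  simp only [partialEval, map_sub, aeval_X, lt_self_iff_false, if_false, algHom_C, algebraMap_eq]
  intro h0
  have := congrArg (coeff (Finsupp.single ⟨i, hi⟩ 1)) h0
  have hne : (0 : Fin n →₀ ℕ) ≠ Finsupp.single ⟨i, hi⟩ 1 := by simp [eq_comm]
  simp [coeff_C, hne] at this

open MvPolynomial in
/-- A finite free algebra over a polynomial ring is Cohen–Macaulay. -/
theorem isCohenMacaulay_of_free {n : ℕ} (A : Type*) [CommRing A]
    [Algebra (MvPolynomial (Fin n) ℂ) A] [Module.Finite (MvPolynomial (Fin n) ℂ) A]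
    [Module.Free (MvPolynomial (Fin n) ℂ) A] : IsCohenMacaulay A := by
  classical
  have hN : IsNoetherianRing A := isNoetherian_of_tower _ <|
    isNoetherian_of_isNoetherianRing_of_finite (MvPolynomial (Fin n) ℂ) A
  refine ⟨hN, fun m _ => ?_⟩
  have hNm : IsNoetherianRing (Localization.AtPrime m) :=
    IsLocalization.isNoetherianRing m.primeCompl _ hN
  refine ⟨hNm, le_antisymm (localDepth_le_ringKrullDim _) ?_⟩
  have hmax : (m.comap (algebraMap (MvPolynomial (Fin n) ℂ) A)).IsMaximal :=
    Ideal.isMaximal_comap_of_isIntegral_of_isMaximal m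
  -- By the Nullstellensatz m lies over a point c. The regular sequence X i - C (c i) stays regular
  -- in A by flatness and then in the localization, so the depth is at least n.
  obtain ⟨c, hc⟩ := isMaximal_iff_eq_vanishingIdeal_singleton.mp hmax
  have hmem : ∀ i, algebraMap _ A (X i - C (c i)) ∈ m := by
    intro i
    rw [← Ideal.mem_comap, hc, mem_vanishingIdeal_singleton_iff]
    simp
  have hreg := (isWeaklyRegular_X_sub_C c).of_flat (S := A)
  have hmem' : ∀ r ∈ (List.ofFn fun i => X i - C (c i)).map (algebraMap (MvPolynomial (Fin n) ℂ) A),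
      r ∈ m := by
    simp only [List.mem_map, List.mem_ofFn]
    rintro _ ⟨_, ⟨i, rfl⟩, rfl⟩
    exact hmem i
  have hreg' := hreg.isRegular_of_isLocalization_of_mem (Localization.AtPrime m) m hmem'
  have hdepth := le_localDepth _ (by
    intro r hr
    rw [List.mem_map] at hr
    obtain ⟨r, hr, rfl⟩ := hr
    exact (IsLocalization.AtPrime.to_map_mem_maximal_iff _ m r).mpr (hmem' r hr)) hreg'
  simp only [List.length_map, List.length_ofFn] at hdepth
  -- m is minimal over the images of the X i - C (c i): a prime q ≤ m containing them lies over the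
  -- same maximal ideal, so it is maximal by integrality. Krull's height theorem gives the bound n.
  have hdim : ringKrullDim (Localization.AtPrime m) ≤ (n : ℕ∞) := by
    rw [IsLocalization.AtPrime.ringKrullDim_eq_height m, WithBot.coe_le_coe]
    have hs : m ∈ (Ideal.span (((Finset.univ.image fun i => algebraMap _ A (X i - C (c i))) :
        Finset A) : Set A)).minimalPrimes := by
      refine ⟨⟨inferInstance, Ideal.span_le.mpr ?_⟩, ?_⟩
      · intro r hr
        simp only [Finset.coe_image, Finset.coe_univ, Set.image_univ, Set.mem_range] at hr
        obtain ⟨i, rfl⟩ := hr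
        exact hmem i
      · rintro q ⟨hq, hsq⟩ hqm
        have hq' : (q.comap (algebraMap (MvPolynomial (Fin n) ℂ) A)).IsMaximal := by
          have hle : m.comap (algebraMap (MvPolynomial (Fin n) ℂ) A) ≤
              q.comap (algebraMap _ A) := by
            have h1 : m.comap (algebraMap (MvPolynomial (Fin n) ℂ) A) =
                Ideal.span ((fun i => X i - C (c i)) '' {_i : Fin n | True}) := by
              have h2 := ker_partialEval c fun _ => True
              rw [← h2, hc]
              ext f
              rw [mem_vanishingIdeal_singleton_iff, RingHom.mem_ker]
              have : partialEval c (fun _ => True) f = C (aeval c f) := by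
                have : partialEval c (fun _ => True) =
                    (Algebra.ofId ℂ (MvPolynomial (Fin n) ℂ)).comp (aeval c) := by
                  ext i : 1
                  simp [Algebra.ofId_apply, partialEval]
                rw [this]
                rfl
              rw [this, C_eq_zero]
            rw [h1, Ideal.span_le]
            rintro _ ⟨i, -, rfl⟩
            exact hsq (Ideal.subset_span (by simp))
          have := hmax.eq_of_le (Ideal.IsPrime.ne_top inferInstance) hle
          exact this ▸ hmax
        have : q.IsMaximal := Ideal.isMaximal_of_isIntegral_of_isMaximal_comap q hq'
        exact (this.eq_of_le (Ideal.IsPrime.ne_top inferInstance) hqm).ge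
    refine (Ideal.height_le_card_of_mem_minimalPrimes_span_finset hs).trans ?_
    exact_mod_cast Finset.card_image_le.trans (by simp)
  refine hdim.trans ?_
  exact_mod_cast hdepth

end

/-! ### Buchberger's criterion for a weight filtration -/

section

section Groebner

open MvPolynomial Finsupp

variable {σ ι k : Type*} [CommRing k]

/-- Polynomials all of whose monomials have weight at least `v`. -/
noncomputable def weightGE (k : Type*) [CommRing k] (ω : σ → ℤ) (v : ℤ) :
    Submodule k (MvPolynomial σ k) :=
  restrictSupport k {m | v ≤ weight ω m}

/-- The span of the multiples `m * g i` for which `m` times the leading monomial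
`X (a i) * X (b i)` of `g i` has weight at least `v`. -/
noncomputable def multSpan (ω : σ → ℤ) (g : ι → MvPolynomial σ k) (a b : ι → σ) (v : ℤ) :
    Submodule k (MvPolynomial σ k) :=
  Submodule.span k {f | ∃ m i, v ≤ weight ω m + (ω (a i) + ω (b i)) ∧ f = monomial m 1 * g i}

theorem mem_weightGE_iff {ω : σ → ℤ} {v : ℤ} {f : MvPolynomial σ k} :
    f ∈ weightGE k ω v ↔ ∀ m, coeff m f ≠ 0 → v ≤ weight ω m := by
  rw [weightGE, mem_restrictSupport_iff]
  exact ⟨fun h m hm => h (MvPolynomial.mem_support_iff.mpr hm),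
    fun h m hm => h m (MvPolynomial.mem_support_iff.mp hm)⟩

theorem weightGE_anti {ω : σ → ℤ} {v w : ℤ} (h : v ≤ w) : weightGE k ω w ≤ weightGE k ω v :=
  restrictSupport_mono _ fun _ hm => h.trans hm

theorem monomial_mem_weightGE {ω : σ → ℤ} {v : ℤ} {m : σ →₀ ℕ} (r : k) (h : v ≤ weight ω m) :
    monomial m r ∈ weightGE k ω v :=
  (monomial_mem_restrictSupport (R := k)).mpr (Or.inl h)

theorem mul_mem_weightGE {ω : σ → ℤ} {u v w : ℤ} {f f' : MvPolynomial σ k}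
    (h : f ∈ weightGE k ω u) (h' : f' ∈ weightGE k ω v) (hw : w ≤ u + v) :
    f * f' ∈ weightGE k ω w := by
  classical
  rw [mem_weightGE_iff] at h h' ⊢
  intro m hm
  rw [coeff_mul] at hm
  obtain ⟨⟨p, q⟩, hpq, hne⟩ := Finset.exists_ne_zero_of_sum_ne_zero hm
  rw [Finset.HasAntidiagonal.mem_antidiagonal] at hpq
  have h1 := h p (left_ne_zero_of_mul hne)
  have h2 := h' q (right_ne_zero_of_mul hne)
  change p + q = m at hpq
  change u ≤ weight ω p at h1
  change v ≤ weight ω q at h2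
  rw [← hpq, map_add]
  omega

theorem X_mem_weightGE {ω : σ → ℤ} (c : σ) : (X c : MvPolynomial σ k) ∈ weightGE k ω (ω c) :=
  monomial_mem_weightGE 1 (by simp [weight_single])

theorem coeff_eq_zero_of_mem_weightGE {ω : σ → ℤ} {v : ℤ} {f : MvPolynomial σ k}
    (h : f ∈ weightGE k ω v) {m : σ →₀ ℕ} (hm : weight ω m < v) : coeff m f = 0 := by
  by_contra hne
  have := mem_weightGE_iff.mp h m hne
  omega

theorem multSpan_anti {ω : σ → ℤ} {g : ι → MvPolynomial σ k} {a b : ι → σ} {v w : ℤ} (h : v ≤ w) :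
    multSpan ω g a b w ≤ multSpan ω g a b v :=
  Submodule.span_mono fun _ ⟨m, i, hmi, hf⟩ => ⟨m, i, h.trans hmi, hf⟩

theorem mul_mem_multSpan {ω : σ → ℤ} {g : ι → MvPolynomial σ k} {a b : ι → σ} {u w : ℤ}
    {f : MvPolynomial σ k} (hf : f ∈ weightGE k ω u) (i : ι) (hw : w ≤ u + (ω (a i) + ω (b i))) :
    f * g i ∈ multSpan ω g a b w := by
  have : weightGE k ω u ≤ (multSpan ω g a b w).comap (LinearMap.mulRight k (g i)) := by
    rw [weightGE, restrictSupport_eq_span, Submodule.span_le]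
    rintro _ ⟨m, hm, rfl⟩
    have hm : u ≤ weight ω m := hm
    exact Submodule.subset_span ⟨m, i, by omega, rfl⟩
  exact this hf

theorem monomial_mul_mem_multSpan {ω : σ → ℤ} {g : ι → MvPolynomial σ k} {a b : ι → σ} {v w : ℤ}
    {f : MvPolynomial σ k} (hf : f ∈ multSpan ω g a b v) (m : σ →₀ ℕ)
    (hw : w ≤ weight ω m + v) : monomial m 1 * f ∈ multSpan ω g a b w := by
  have : multSpan ω g a b v ≤ (multSpan ω g a b w).comap (LinearMap.mulLeft k (monomial m 1)) := by
    rw [multSpan, Submodule.span_le]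
    rintro _ ⟨n, i, hn, rfl⟩
    refine Submodule.subset_span ⟨m + n, i, ?_, ?_⟩
    · rw [map_add]; omega
    · simp [LinearMap.mulLeft_apply, ← mul_assoc, monomial_mul]
  exact this hf

variable (ω : σ → ℤ) (g : ι → MvPolynomial σ k) (a b : ι → σ)

/-- The exponent of the leading monomial of `g i`. -/
noncomputable def leadExp (i : ι) : σ →₀ ℕ := single (a i) 1 + single (b i) 1

/-- A family of quadratic polynomials with monic quadratic leading monomials for the weight `ω`,
all of whose overlaps resolve. -/
structure IsResolving : Prop where
  tail : ∀ i, g i - X (a i) * X (b i) ∈ weightGE k ω (ω (a i) + ω (b i) + 1)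
  inj : ∀ i j, leadExp a b i = leadExp a b j → i = j
  overlap : ∀ i j p q r, leadExp a b i = single p 1 + single q 1 →
    leadExp a b j = single p 1 + single r 1 → q ≠ r →
    X r * g i - X q * g j ∈ multSpan ω g a b (ω p + ω q + ω r + 1)

variable {ω g a b}

namespace IsResolving

theorem weight_leadExp (i : ι) : weight ω (leadExp a b i) = ω (a i) + ω (b i) := by
  simp [leadExp, weight_single]

theorem monomial_leadExp (i : ι) :
    (monomial (leadExp a b i) 1 : MvPolynomial σ k) = X (a i) * X (b i) := by
  simp [leadExp, X, monomial_mul]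

theorem tail_mul (h : IsResolving ω g a b) (m : σ →₀ ℕ) (i : ι) :
    monomial m 1 * g i - monomial (m + leadExp a b i) 1 ∈
      weightGE k ω (weight ω m + (ω (a i) + ω (b i)) + 1) := by
  have : monomial m 1 * g i - monomial (m + leadExp a b i) 1 =
      monomial m 1 * (g i - X (a i) * X (b i)) := by
    rw [← monomial_leadExp, mul_sub, monomial_mul, one_mul]
  rw [this]
  exact mul_mem_weightGE (monomial_mem_weightGE 1 le_rfl) (h.tail i) (by omega)

theorem gen_mem_weightGE (h : IsResolving ω g a b) (i : ι) :
    g i ∈ weightGE k ω (ω (a i) + ω (b i)) := by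
  rw [← sub_add_cancel (g i) (X (a i) * X (b i))]
  exact add_mem (weightGE_anti (by omega) (h.tail i))
    (mul_mem_weightGE (X_mem_weightGE _) (X_mem_weightGE _) le_rfl)

theorem multSpan_le_weightGE (h : IsResolving ω g a b) (v : ℤ) :
    multSpan ω g a b v ≤ weightGE k ω v := by
  rw [multSpan, Submodule.span_le]
  rintro _ ⟨m, i, hm, rfl⟩
  exact mul_mem_weightGE (monomial_mem_weightGE 1 le_rfl) (h.gen_mem_weightGE i) hm

theorem sub_mem_of_share (h : IsResolving ω g a b) {i j : ι} {m m' : σ →₀ ℕ}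
    (hmm : m + leadExp a b i = m' + leadExp a b j) {p q r : σ}
    (hi : leadExp a b i = single p 1 + single q 1) (hj : leadExp a b j = single p 1 + single r 1) :
    monomial m 1 * g i - monomial m' 1 * g j ∈
      multSpan ω g a b (weight ω (m + leadExp a b i) + 1) := by
  classical
  by_cases hqr : q = r
  · subst hqr
    obtain rfl := h.inj i j (hi.trans hj.symm)
    rw [add_right_cancel hmm, sub_self]
    exact zero_mem _
  have h1 : m + single q 1 = m' + single r 1 := by
    rw [hi, hj] at hmm
    apply add_left_cancel (a := single p 1)
    rw [← add_assoc, ← add_assoc, add_comm _ m, add_comm _ m', add_assoc, add_assoc, hmm]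
  have hr : single r 1 ≤ m := by
    rw [single_le_iff]
    have := DFunLike.congr_fun h1 r
    simp [hqr] at this
    omega
  obtain ⟨n, rfl⟩ := exists_add_of_le hr
  have h2 : m' = single q 1 + n := by
    apply add_right_cancel (b := single r 1)
    rw [← h1]; abel
  subst h2
  have := monomial_mul_mem_multSpan (h.overlap i j p q r hi hj hqr) n
    (w := weight ω (single r 1 + n + leadExp a b i) + 1) (by
      rw [hi]; simp only [map_add, weight_single, one_smul]; omega)
  convert this using 1
  rw [mul_sub, ← mul_assoc, ← mul_assoc, X, X, monomial_mul, monomial_mul, add_comm n, add_comm n,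
    one_mul]

/-- Coprime leading monomials L_i, L_j need no hypothesis: L_j g_i - L_i g_j = (g_i - L_i) g_j -
(g_j - L_j) g_i, and the tails have greater weight. -/
theorem sub_mem_of_disjoint (h : IsResolving ω g a b) {i j : ι} {m m' : σ →₀ ℕ}
    (hmm : m + leadExp a b i = m' + leadExp a b j)
    (hd : a i ≠ a j ∧ a i ≠ b j ∧ b i ≠ a j ∧ b i ≠ b j) :
    monomial m 1 * g i - monomial m' 1 * g j ∈
      multSpan ω g a b (weight ω (m + leadExp a b i) + 1) := by
  classical
  obtain ⟨h1, h2, h3, h4⟩ := hd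
  have hle : leadExp a b j ≤ m := by
    intro x
    have := DFunLike.congr_fun hmm x
    simp only [leadExp, Finsupp.add_apply, single_apply] at this ⊢
    split_ifs at this ⊢ <;> first | omega | (exfalso; simp_all)
  obtain ⟨n, rfl⟩ := exists_add_of_le hle
  have hm' : m' = leadExp a b i + n := by
    apply add_right_cancel (b := leadExp a b j)
    rw [← hmm]; abel
  subst hm'
  have key : monomial (leadExp a b j + n) 1 * g i - monomial (leadExp a b i + n) 1 * g j =
      monomial n 1 * ((g i - X (a i) * X (b i)) * g j - (g j - X (a j) * X (b j)) * g i) := by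
    have : ∀ e : σ →₀ ℕ, (monomial (e + n) 1 : MvPolynomial σ k) = monomial n 1 * monomial e 1 := by
      intro e; rw [monomial_mul, one_mul, add_comm]
    rw [this, this, monomial_leadExp, monomial_leadExp]
    ring
  rw [key]
  refine monomial_mul_mem_multSpan (sub_mem (mul_mem_multSpan (h.tail i) j le_rfl)
    (mul_mem_multSpan (h.tail j) i ?_)) n ?_
  · omega
  · simp only [map_add, weight_leadExp]; omega

theorem sub_mem (h : IsResolving ω g a b) {i j : ι} {m m' : σ →₀ ℕ}
    (hmm : m + leadExp a b i = m' + leadExp a b j) :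
    monomial m 1 * g i - monomial m' 1 * g j ∈
      multSpan ω g a b (weight ω (m + leadExp a b i) + 1) := by
  by_cases h1 : a i = a j
  · exact h.sub_mem_of_share hmm (p := a i) rfl (by rw [h1]; rfl)
  by_cases h2 : a i = b j
  · exact h.sub_mem_of_share hmm (p := a i) rfl (by rw [h2, add_comm]; rfl)
  by_cases h3 : b i = a j
  · exact h.sub_mem_of_share hmm (p := b i) (add_comm _ _) (by rw [h3]; rfl)
  by_cases h4 : b i = b j
  · exact h.sub_mem_of_share hmm (p := b i) (add_comm _ _) (by rw [h4, add_comm]; rfl)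
  exact h.sub_mem_of_disjoint hmm ⟨h1, h2, h3, h4⟩

/-- Ψ sends a monomial of weight v divisible by some leading monomial to the class of one chosen
multiple `m * g i` with that leading term, and all other monomials to 0. By `sub_mem` the choice is
immaterial modulo `multSpan` of v + 1, so Ψ agrees with the quotient map on `multSpan` of v. It also
kills all weights above v, so the class of f vanishes. -/
theorem mem_multSpan_succ (h : IsResolving ω g a b) {v : ℤ} {f : MvPolynomial σ k}
    (hf : f ∈ multSpan ω g a b v) (hf' : f ∈ weightGE k ω (v + 1)) :
    f ∈ multSpan ω g a b (v + 1) := by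
  classical
  let Q := MvPolynomial σ k ⧸ multSpan ω g a b (v + 1)
  let ψ : (σ →₀ ℕ) → Q := fun M =>
    if hM : weight ω M = v ∧ ∃ mi : (σ →₀ ℕ) × ι, M = mi.1 + leadExp a b mi.2 then
      Submodule.Quotient.mk (monomial hM.2.choose.1 1 * g hM.2.choose.2) else 0
  let Ψ : MvPolynomial σ k →ₗ[k] Q := (basisMonomials σ k).constr k ψ
  have hΨ : ∀ M, Ψ (monomial M 1) = ψ M := by
    intro M
    have := (basisMonomials σ k).constr_basis k ψ M
    rwa [coe_basisMonomials] at this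
  have hΨ0 : weightGE k ω (v + 1) ≤ LinearMap.ker Ψ := by
    rw [weightGE, restrictSupport_eq_span, Submodule.span_le]
    rintro _ ⟨M, hM, rfl⟩
    have hM : v + 1 ≤ weight ω M := hM
    rw [SetLike.mem_coe, LinearMap.mem_ker, hΨ]
    exact dif_neg fun hM' => by omega
  have hΨmk : multSpan ω g a b v ≤
      LinearMap.ker (Ψ - Submodule.mkQ (multSpan ω g a b (v + 1))) := by
    rw [multSpan, Submodule.span_le]
    rintro _ ⟨m, i, hm, rfl⟩
    rw [SetLike.mem_coe, LinearMap.mem_ker, LinearMap.sub_apply, sub_eq_zero]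
    rcases hm.eq_or_lt with hm | hm
    · have h1 : Ψ (monomial m 1 * g i) = ψ (m + leadExp a b i) := by
        rw [← hΨ, ← sub_eq_zero, ← map_sub]
        exact hΨ0 (weightGE_anti (by omega) (h.tail_mul m i))
      have hM : weight ω (m + leadExp a b i) = v ∧
          ∃ mi : (σ →₀ ℕ) × ι, m + leadExp a b i = mi.1 + leadExp a b mi.2 :=
        ⟨by rw [map_add, weight_leadExp]; omega, ⟨(m, i), rfl⟩⟩
      rw [h1]
      refine (dif_pos hM).trans ?_
      rw [Submodule.mkQ_apply, Submodule.Quotient.eq, ← neg_sub]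
      refine neg_mem ?_
      exact multSpan_anti (by rw [hM.1]) (h.sub_mem hM.2.choose_spec)
    · have hmem : monomial m 1 * g i ∈ multSpan ω g a b (v + 1) :=
        Submodule.subset_span ⟨m, i, by omega, rfl⟩
      have h1 : Ψ (monomial m 1 * g i) = 0 := hΨ0 (h.multSpan_le_weightGE _ hmem)
      rw [h1, Submodule.mkQ_apply, (Submodule.Quotient.mk_eq_zero _).mpr hmem]
  have h1 : Ψ f = 0 := hΨ0 hf'
  have h2 : Ψ f - Submodule.mkQ _ f = 0 := hΨmk hf
  rw [h1, zero_sub, neg_eq_zero, Submodule.mkQ_apply] at h2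
  exact (Submodule.Quotient.mk_eq_zero _).mp h2

/-- Only finitely many steps lead from the initial bound up to w, so no well-founded monomial order
is needed. -/
theorem mem_multSpan_of_mem_weightGE (h : IsResolving ω g a b) {w : ℤ} (n : ℕ) :
    ∀ {f : MvPolynomial σ k}, f ∈ multSpan ω g a b (w - n) → f ∈ weightGE k ω w →
      f ∈ multSpan ω g a b w := by
  induction n with
  | zero => intro f hf _; simpa using hf
  | succ n ih =>
    intro f hf hf'
    refine ih ?_ hf'
    have := h.mem_multSpan_succ hf (weightGE_anti (by push_cast; omega) hf')
    convert this using 2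
    push_cast; ring

theorem exists_mem_multSpan {f : MvPolynomial σ k} (hf : f ∈ Ideal.span (Set.range g)) :
    ∃ v, f ∈ multSpan ω g a b v := by
  induction hf using Submodule.span_induction with
  | mem x hx =>
    obtain ⟨i, rfl⟩ := hx
    exact ⟨_, Submodule.subset_span ⟨0, i, le_rfl, by simp⟩⟩
  | zero => exact ⟨0, zero_mem _⟩
  | add x y _ _ hx hy =>
    obtain ⟨v, hv⟩ := hx
    obtain ⟨w, hw⟩ := hy
    exact ⟨min v w, add_mem (multSpan_anti (min_le_left _ _) hv)
      (multSpan_anti (min_le_right _ _) hw)⟩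
  | smul p x _ hx =>
    obtain ⟨v, hv⟩ := hx
    induction p using MvPolynomial.induction_on' with
    | monomial m r =>
      have := Submodule.smul_mem _ r
        (monomial_mul_mem_multSpan hv m (w := weight ω m + v) le_rfl)
      rw [← smul_mul_assoc, smul_monomial, smul_eq_mul, mul_one] at this
      exact ⟨_, this⟩
    | add p q hp hq =>
      obtain ⟨v, hv⟩ := hp
      obtain ⟨w, hw⟩ := hq
      refine ⟨min v w, ?_⟩
      rw [add_smul]
      exact add_mem (multSpan_anti (min_le_left _ _) hv) (multSpan_anti (min_le_right _ _) hw)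

/-- An element of the ideal all of whose monomials have weight at least `w` does not involve
a monomial of weight `w` that is not divisible by a leading monomial. -/
theorem coeff_eq_zero (h : IsResolving ω g a b) {w : ℤ} {f : MvPolynomial σ k}
    (hf : f ∈ Ideal.span (Set.range g)) (hf' : f ∈ weightGE k ω w) {s : σ →₀ ℕ}
    (hs : ∀ i, ¬ leadExp a b i ≤ s) (hsw : weight ω s ≤ w) : coeff s f = 0 := by
  classical
  obtain ⟨v, hv⟩ := exists_mem_multSpan (ω := ω) (a := a) (b := b) hf
  have hfw : f ∈ multSpan ω g a b w :=
    h.mem_multSpan_of_mem_weightGE (w - v).toNat (multSpan_anti (by omega) hv) hf'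
  have : multSpan ω g a b w ≤ LinearMap.ker (lcoeff k s) := by
    rw [multSpan, Submodule.span_le]
    rintro _ ⟨m, i, hm, rfl⟩
    rw [SetLike.mem_coe, LinearMap.mem_ker, lcoeff_apply]
    have h1 := coeff_eq_zero_of_mem_weightGE (h.tail_mul m i) (m := s) (by omega)
    rw [coeff_sub, sub_eq_zero] at h1
    rw [h1, coeff_monomial, if_neg]
    rintro rfl
    exact hs i le_add_self
  exact this hfw

end IsResolving

end Groebner

end

/-! ### The affine diagram inside ℤ × ℤ; tables of quadrics and syzygies -/

section

namespace EHat

/-- The coordinates of a spinor weight in the embedding of the affine diagram into `ℤ × ℤ`. -/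
def coord : E → ℤ × ℤ
  | .lam => (0, 0) | .w12 => (1, 0) | .w13 => (2, 0) | .w14 => (2, 1)
  | .w15 => (2, 2) | .w23 => (3, 0) | .w24 => (3, 1) | .w25 => (3, 2)
  | .w34 => (4, 1) | .w35 => (4, 2) | .w45 => (4, 3)
  | .p1 => (7, 3) | .p2 => (6, 3) | .p3 => (5, 3) | .p4 => (5, 2) | .p5 => (5, 1)

/-- The first coordinate of the embedding of the affine diagram into `ℤ × ℤ`. -/
def x (a : EHat) : ℤ := (coord a.weight).1 + 4 * a.mode

/-- The second coordinate of the embedding of the affine diagram into `ℤ × ℤ`. -/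
def y (a : EHat) : ℤ := (coord a.weight).2 + 4 * a.mode

theorem ht_eq (a : EHat) : a.ht = a.x + a.y := by
  obtain ⟨α, r⟩ := a
  cases α <;> simp [EHat.ht, E.ht, x, y, coord] <;> ring

/-- By `exists_coord` these conditions describe the image of the embedding exactly. -/
theorem coord_mem (a : EHat) : 0 ≤ a.x - a.y ∧ a.x - a.y ≤ 4 ∧
    (a.x - a.y = 0 → a.x % 2 = 0) ∧ (a.x - a.y = 4 → a.x % 2 = 1) := by
  obtain ⟨α, r⟩ := a
  cases α <;> simp only [x, y, coord] <;> omega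

theorem ext_coord {a b : EHat} (hx : a.x = b.x) (hy : a.y = b.y) : a = b := by
  obtain ⟨α, r⟩ := a
  obtain ⟨β, q⟩ := b
  simp only [x, y] at hx hy
  have : α = β ∧ r = q := by
    cases α <;> cases β <;> simp only [coord] at hx hy <;>
      first | exact ⟨rfl, by omega⟩ | omega
  rw [this.1, this.2]

theorem exists_coord {u v : ℤ} (h0 : 0 ≤ u - v) (h4 : u - v ≤ 4) (h0' : u - v = 0 → u % 2 = 0)
    (h4' : u - v = 4 → u % 2 = 1) : ∃ a : EHat, a.x = u ∧ a.y = v := by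
  obtain ⟨q, e, he, he', rfl⟩ : ∃ q e : ℤ, 0 ≤ e ∧ e < 4 ∧ v = e + 4 * q :=
    ⟨v / 4, v % 4, by omega, by omega, by omega⟩
  obtain ⟨t, ht⟩ : ∃ t, u = e + t + 4 * q := ⟨u - e - 4 * q, by ring⟩
  subst ht
  have h0 : 0 ≤ t := by omega
  have h4 : t ≤ 4 := by omega
  have key : ∃ α, (coord α).1 = e + t ∧ (coord α).2 = e := by
    interval_cases e <;> interval_cases t
    all_goals first
      | omega
      | exact ⟨.lam, rfl, rfl⟩ | exact ⟨.w12, rfl, rfl⟩ | exact ⟨.w13, rfl, rfl⟩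
      | exact ⟨.w14, rfl, rfl⟩ | exact ⟨.w15, rfl, rfl⟩ | exact ⟨.w23, rfl, rfl⟩
      | exact ⟨.w24, rfl, rfl⟩ | exact ⟨.w25, rfl, rfl⟩ | exact ⟨.w34, rfl, rfl⟩
      | exact ⟨.w35, rfl, rfl⟩ | exact ⟨.w45, rfl, rfl⟩ | exact ⟨.p1, rfl, rfl⟩
      | exact ⟨.p2, rfl, rfl⟩ | exact ⟨.p3, rfl, rfl⟩ | exact ⟨.p4, rfl, rfl⟩
      | exact ⟨.p5, rfl, rfl⟩
  obtain ⟨α, h1, h2⟩ := key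
  exact ⟨⟨α, q⟩, by simp only [x, h1], by simp only [y, h2]⟩

theorem coord_le_of_arrow {a b : EHat} (h : Arrow a b) : a.x ≤ b.x ∧ a.y ≤ b.y := by
  cases h <;> simp only [x, y, coord] <;> omega

/-- Each arrow is a unit step in x or y. If both leave a, the step in x is taken when b is further
in x, and the step in y otherwise; if only one does, the edge of the strip forces b to that side. -/
theorem exists_arrow {a b : EHat} (hx : a.x ≤ b.x) (hy : a.y ≤ b.y) (hne : a ≠ b) :
    ∃ c, Arrow a c ∧ c.x ≤ b.x ∧ c.y ≤ b.y := by
  have hb := coord_mem b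
  have hne' : a.x ≠ b.x ∨ a.y ≠ b.y := by
    by_contra! h
    exact hne (ext_coord h.1 h.2)
  obtain ⟨α, r⟩ := a
  generalize b.x = u at *
  generalize b.y = v at *
  cases α <;> simp only [x, y, coord] at hx hy hne'
  · exact ⟨_, .a1 r, by simp only [x, y, coord]; omega⟩
  · exact ⟨_, .a2 r, by simp only [x, y, coord]; omega⟩
  · rcases le_or_gt (3 + 4 * r) u with h | h
    · exact ⟨_, .a3 r, by simp only [x, y, coord]; omega⟩
    · exact ⟨_, .a4 r, by simp only [x, y, coord]; omega⟩
  · rcases le_or_gt (3 + 4 * r) u with h | h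
    · exact ⟨_, .a6 r, by simp only [x, y, coord]; omega⟩
    · exact ⟨_, .a7 r, by simp only [x, y, coord]; omega⟩
  · exact ⟨_, .a13 r, by simp only [x, y, coord]; omega⟩
  · exact ⟨_, .a5 r, by simp only [x, y, coord]; omega⟩
  · rcases le_or_gt (4 + 4 * r) u with h | h
    · exact ⟨_, .a8 r, by simp only [x, y, coord]; omega⟩
    · exact ⟨_, .a9 r, by simp only [x, y, coord]; omega⟩
  · exact ⟨_, .a14 r, by simp only [x, y, coord]; omega⟩
  · rcases le_or_gt (5 + 4 * r) u with h | h
    · exact ⟨_, .a10 r, by simp only [x, y, coord]; omega⟩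
    · exact ⟨_, .a11 r, by simp only [x, y, coord]; omega⟩
  · rcases le_or_gt (5 + 4 * r) u with h | h
    · exact ⟨_, .a15 r, by simp only [x, y, coord]; omega⟩
    · exact ⟨_, .a16 r, by simp only [x, y, coord]; omega⟩
  · rcases le_or_gt (5 + 4 * r) u with h | h
    · exact ⟨_, .a18 r, by simp only [x, y, coord]; omega⟩
    · exact ⟨_, .b1 r, by simp only [x, y, coord]; omega⟩
  · exact ⟨_, .b4 r, by simp only [x, y, coord]; omega⟩
  · rcases le_or_gt (7 + 4 * r) u with h | h
    · exact ⟨_, .a20 r, by simp only [x, y, coord]; omega⟩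
    · exact ⟨_, .b3 r, by simp only [x, y, coord]; omega⟩
  · rcases le_or_gt (6 + 4 * r) u with h | h
    · exact ⟨_, .a19 r, by simp only [x, y, coord]; omega⟩
    · exact ⟨_, .b2 r, by simp only [x, y, coord]; omega⟩
  · exact ⟨_, .a17 r, by simp only [x, y, coord]; omega⟩
  · exact ⟨_, .a12 r, by simp only [x, y, coord]; omega⟩

theorem le_of_coord_le (n : ℕ) :
    ∀ {a b : EHat}, a.x ≤ b.x → a.y ≤ b.y → b.ht - a.ht ≤ n → a ≤ b := by
  induction n with
  | zero =>
    intro a b hx hy h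
    rw [ht_eq, ht_eq] at h
    rw [ext_coord (a := a) (b := b) (by push_cast at h; omega) (by push_cast at h; omega)]
  | succ n ih =>
    intro a b hx hy h
    by_cases hne : a = b
    · rw [hne]
    · obtain ⟨c, hac, hcx, hcy⟩ := exists_arrow hx hy hne
      have := hac.ht_eq
      have hcb : c ≤ b := ih hcx hcy (by push_cast at h; omega)
      exact Relation.ReflTransGen.head hac hcb

theorem le_iff {a b : EHat} : a ≤ b ↔ a.x ≤ b.x ∧ a.y ≤ b.y := by
  refine ⟨fun h => ?_, fun h => le_of_coord_le (b.ht - a.ht).toNat h.1 h.2 (Int.self_le_toNat _)⟩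
  induction (show Relation.ReflTransGen Arrow a b from h) with
  | refl => exact ⟨le_rfl, le_rfl⟩
  | tail hab hbc ih =>
    have h1 := coord_le_of_arrow hbc
    have h2 := ih hab
    omega

theorem exists_ht_eq {a b : EHat} (h : a ≤ b) {n : ℤ} (h1 : a.ht ≤ n) (h2 : n ≤ b.ht) :
    ∃ c, a ≤ c ∧ c ≤ b ∧ c.ht = n := by
  induction (show Relation.ReflTransGen Arrow a b from h) with
  | refl => exact ⟨a, le_rfl, le_rfl, by omega⟩
  | @tail b c hab hbc ih =>
    by_cases hn : n ≤ b.ht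
    · obtain ⟨e, he1, he2, he3⟩ := ih hab hn
      exact ⟨e, he1, he2.trans (Relation.ReflTransGen.single hbc), he3⟩
    · have := hbc.ht_eq
      exact ⟨c, h, le_rfl, by omega⟩

end EHat

instance : DecidableEq E := fun a b =>
  decidable_of_iff (a.ctorIdx = b.ctorIdx)
    ⟨fun h => by cases a <;> cases b <;> first | rfl | exact absurd h (by decide),
      fun h => by rw [h]⟩

instance : DecidableEq G := fun a b =>
  decidable_of_iff (a.ctorIdx = b.ctorIdx)
    ⟨fun h => by cases a <;> cases b <;> first | rfl | exact absurd h (by decide),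
      fun h => by rw [h]⟩

instance : DecidableEq EHat := fun a b =>
  decidable_of_iff (a.weight = b.weight ∧ a.mode = b.mode) EHat.ext_iff.symm

/-- The list of the spinor weights. -/
def weightList : List E :=
  [.lam, .w12, .w13, .w14, .w15, .w23, .w24, .w25, .w34, .w35, .w45, .p1, .p2, .p3, .p4, .p5]

/-- The list of the vector weights. -/
def vectorList : List G := [.v1, .v2, .v3, .v4, .v5, .v1s, .v2s, .v3s, .v4s, .v5s]

theorem mem_weightList (α : E) : α ∈ weightList := by cases α <;> decide

theorem mem_vectorList (s : G) : s ∈ vectorList := by cases s <;> decide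

instance : Fintype E where
  elems := ⟨weightList, by decide⟩
  complete := mem_weightList

/-- The quadric `Γ^s` is the sum over `α` of `c λ^α λ^β`, where `(c, β) = quadTerm s α`. -/
def quadTerm : G → E → ℤ × E
  | .v1, .p1 => (1, .lam) | .v1, .w25 => (1, .w34) | .v1, .w24 => (-1, .w35)
  | .v1, .w23 => (1, .w45)
  | .v2, .p2 => (-1, .lam) | .v2, .w15 => (-1, .w34) | .v2, .w14 => (1, .w35)
  | .v2, .w13 => (-1, .w45)
  | .v3, .p3 => (1, .lam) | .v3, .w15 => (1, .w24) | .v3, .w14 => (-1, .w25)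
  | .v3, .w12 => (1, .w45)
  | .v4, .p4 => (-1, .lam) | .v4, .w15 => (-1, .w23) | .v4, .w13 => (1, .w25)
  | .v4, .w12 => (-1, .w35)
  | .v5, .p5 => (1, .lam) | .v5, .w14 => (1, .w23) | .v5, .w13 => (-1, .w24)
  | .v5, .w12 => (1, .w34)
  | .v1s, .p2 => (-1, .w12) | .v1s, .p3 => (1, .w13) | .v1s, .p4 => (-1, .w14)
  | .v1s, .p5 => (1, .w15)
  | .v2s, .p1 => (-1, .w12) | .v2s, .p3 => (1, .w23) | .v2s, .p4 => (-1, .w24)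
  | .v2s, .p5 => (1, .w25)
  | .v3s, .p1 => (-1, .w13) | .v3s, .p2 => (1, .w23) | .v3s, .p4 => (-1, .w34)
  | .v3s, .p5 => (1, .w35)
  | .v4s, .p1 => (-1, .w14) | .v4s, .p2 => (1, .w24) | .v4s, .p3 => (-1, .w34)
  | .v4s, .p5 => (1, .w45)
  | .v5s, .p1 => (-1, .w15) | .v5s, .p2 => (1, .w25) | .v5s, .p3 => (-1, .w35)
  | .v5s, .p4 => (1, .w45)
  | _, _ => (0, .lam)

/-- The weights of the incomparable pair in `Γ^{s^n}` for even `n`. -/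
def evenLead : G → E × E
  | .v1 => (.w25, .w34)
  | .v2 => (.w15, .w34)
  | .v3 => (.w15, .w24)
  | .v4 => (.w15, .w23)
  | .v5 => (.w14, .w23)
  | .v1s => (.p5, .w15)
  | .v2s => (.p5, .w25)
  | .v3s => (.p5, .w35)
  | .v4s => (.p5, .w45)
  | .v5s => (.p4, .w45)

/-- The weights of the incomparable pair in `Γ^{s^n}` for odd `n`. -/
def oddLead : G → E × E
  | .v1 => (.p1, .lam)
  | .v2 => (.p2, .lam)
  | .v3 => (.p3, .lam)
  | .v4 => (.p4, .lam)
  | .v5 => (.p5, .lam)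
  | .v1s => (.p2, .w12)
  | .v2s => (.p1, .w12)
  | .v3s => (.p1, .w13)
  | .v4s => (.p1, .w14)
  | .v5s => (.p1, .w15)

/-- The linear syzygies of the quadrics: for each `γ`, the sum over `α` of `c λ^α Γ^s` vanishes,
where `(c, s) = syzTerm γ α`. -/
def syzTerm : E → E → ℤ × G
  | .lam, .lam => (-1, .v1s) | .lam, .w12 => (1, .v2) | .lam, .w13 => (1, .v3)
  | .lam, .w14 => (1, .v4) | .lam, .w15 => (1, .v5)
  | .w12, .lam => (-1, .v2s) | .w12, .w12 => (-1, .v1) | .w12, .w23 => (1, .v3)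
  | .w12, .w24 => (1, .v4) | .w12, .w25 => (1, .v5)
  | .w13, .lam => (-1, .v3s) | .w13, .w13 => (-1, .v1) | .w13, .w23 => (-1, .v2)
  | .w13, .w34 => (1, .v4) | .w13, .w35 => (1, .v5)
  | .w14, .lam => (-1, .v4s) | .w14, .w14 => (-1, .v1) | .w14, .w24 => (-1, .v2)
  | .w14, .w34 => (-1, .v3) | .w14, .w45 => (1, .v5)
  | .w23, .lam => (1, .v5s) | .w23, .w15 => (1, .v1) | .w23, .w25 => (1, .v2)
  | .w23, .w35 => (1, .v3) | .w23, .w45 => (1, .v4)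
  | .w15, .w12 => (1, .v3s) | .w15, .w13 => (-1, .v2s) | .w15, .w23 => (1, .v1s)
  | .w15, .p5 => (1, .v4) | .w15, .p4 => (1, .v5)
  | .w24, .w12 => (1, .v4s) | .w24, .w14 => (-1, .v2s) | .w24, .w24 => (1, .v1s)
  | .w24, .p5 => (-1, .v3) | .w24, .p3 => (1, .v5)
  | .w25, .w12 => (-1, .v5s) | .w25, .w15 => (1, .v2s) | .w25, .w25 => (-1, .v1s)
  | .w25, .p4 => (1, .v3) | .w25, .p3 => (1, .v4)
  | .w34, .w13 => (1, .v4s) | .w34, .w14 => (-1, .v3s) | .w34, .w34 => (1, .v1s)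
  | .w34, .p5 => (1, .v2) | .w34, .p2 => (1, .v5)
  | .w35, .w13 => (-1, .v5s) | .w35, .w15 => (1, .v3s) | .w35, .w35 => (-1, .v1s)
  | .w35, .p4 => (-1, .v2) | .w35, .p2 => (1, .v4)
  | .p5, .w14 => (1, .v5s) | .p5, .w15 => (-1, .v4s) | .p5, .w45 => (1, .v1s)
  | .p5, .p3 => (1, .v2) | .p5, .p2 => (1, .v3)
  | .w45, .w23 => (1, .v4s) | .w45, .w24 => (-1, .v3s) | .w45, .w34 => (1, .v2s)
  | .w45, .p5 => (-1, .v1) | .w45, .p1 => (1, .v5)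
  | .p4, .w23 => (-1, .v5s) | .p4, .w25 => (1, .v3s) | .p4, .w35 => (-1, .v2s)
  | .p4, .p4 => (1, .v1) | .p4, .p1 => (1, .v4)
  | .p3, .w24 => (1, .v5s) | .p3, .w25 => (-1, .v4s) | .p3, .w45 => (1, .v2s)
  | .p3, .p3 => (-1, .v1) | .p3, .p1 => (1, .v3)
  | .p2, .w34 => (-1, .v5s) | .p2, .w35 => (1, .v4s) | .p2, .w45 => (-1, .v3s)
  | .p2, .p2 => (1, .v1) | .p2, .p1 => (1, .v2)
  | .p1, .p5 => (1, .v5s) | .p1, .p4 => (-1, .v4s) | .p1, .p3 => (1, .v3s)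
  | .p1, .p2 => (-1, .v2s) | .p1, .p1 => (1, .v1s)
  | _, _ => (0, .v1)

theorem sum_weights {M : Type*} [AddCommMonoid M] (f : E → M) :
    ∑ α, f α = f .lam + (f .w12 + (f .w13 + (f .w14 + (f .w15 + (f .w23 + (f .w24 + (f .w25 +
      (f .w34 + (f .w35 + (f .w45 + (f .p1 + (f .p2 + (f .p3 + (f .p4 + f .p5)))))))))))))) := by
  change Multiset.sum (Multiset.map f (Multiset.ofList weightList)) = _
  simp only [weightList, Multiset.map_coe, List.map_cons, List.map_nil, Multiset.sum_coe,
    List.sum_cons, List.sum_nil, add_zero]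

theorem Gam_eq_sum {R : Type*} [CommRing R] (x : E → R) (s : G) :
    Gam x s = ∑ α, ((quadTerm s α).1 : R) * (x α * x (quadTerm s α).2) := by
  rw [sum_weights]
  cases s <;> simp only [Gam, quadTerm, Int.cast_zero, Int.cast_one, Int.cast_neg] <;> ring

theorem sum_syzTerm {R : Type*} [CommRing R] (x : E → R) (γ : E) :
    ∑ α, ((syzTerm γ α).1 : R) * (x α * Gam x (syzTerm γ α).2) = 0 := by
  rw [sum_weights]
  cases γ <;> simp only [Gam, syzTerm, Int.cast_zero, Int.cast_one, Int.cast_neg] <;> ring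

end

/-! ### The incomparable pair in each quadric -/

section

/-- The first member of the incomparable pair in `Γ^{s^n}`. -/
def leadA (s : G) (n : ℤ) : EHat :=
  ⟨if n % 2 = 0 then (evenLead s).1 else (oddLead s).1, n / 2⟩

/-- The second member of the incomparable pair in `Γ^{s^n}`. -/
def leadB (s : G) (n : ℤ) : EHat :=
  ⟨if n % 2 = 0 then (evenLead s).2 else (oddLead s).2, n - n / 2⟩

/-- The coefficient of the product of the incomparable pair in `Γ^{s^n}`. -/
def leadSign (s : G) (n : ℤ) : ℤ := (quadTerm s (leadA s n).weight).1

/-- The partner of the factor `λ^a` in `Γ^{s^n}`. -/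
def partner (s : G) (n : ℤ) (a : EHat) : EHat := ⟨(quadTerm s a.weight).2, n - a.mode⟩

theorem partner_leadA (s : G) (n : ℤ) : partner s n (leadA s n) = leadB s n := by
  simp only [partner, leadA, leadB, EHat.mk.injEq, and_true]
  split_ifs <;> cases s <;> rfl

theorem leadSign_mul_self (s : G) (n : ℤ) : leadSign s n * leadSign s n = 1 := by
  simp only [leadSign, leadA]
  split_ifs <;> cases s <;> rfl

theorem leadA_leadB_coord (s : G) (n : ℤ) :
    (leadA s n).x < (leadB s n).x ∧ (leadB s n).y < (leadA s n).y ∨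
    (leadB s n).x < (leadA s n).x ∧ (leadA s n).y < (leadB s n).y := by
  simp only [leadA, leadB, EHat.x, EHat.y]
  split_ifs <;> cases s <;> simp only [evenLead, oddLead, EHat.coord] <;> omega

/-- This serves twice: it makes the incomparable product the term of least weight, and it shows that
a segment containing any pair of factors contains the incomparable pair. -/
theorem coord_bracket (s : G) (n : ℤ) (a : EHat) (h : (quadTerm s a.weight).1 ≠ 0) :
    a.x + (partner s n a).x = (leadA s n).x + (leadB s n).x ∧
    a.y + (partner s n a).y = (leadA s n).y + (leadB s n).y ∧
    (a = leadA s n ∨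
    (a.x ≤ (leadA s n).x ∧ a.x ≤ (leadB s n).x ∧ a.y ≤ (leadA s n).y ∧ a.y ≤ (leadB s n).y) ∨
    ((leadA s n).x ≤ a.x ∧ (leadB s n).x ≤ a.x ∧ (leadA s n).y ≤ a.y ∧ (leadB s n).y ≤ a.y)) := by
  obtain ⟨α, l⟩ := a
  obtain ⟨k, e, rfl, he⟩ : ∃ k e : ℤ, n = e + 2 * k ∧ (e = 0 ∨ e = 1) :=
    ⟨n / 2, n % 2, by omega, by omega⟩
  have h2 : (e + 2 * k) / 2 = k := by omega
  have h3 : (e + 2 * k) % 2 = e := by omega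
  simp only [leadA, leadB, partner, EHat.x, EHat.y, EHat.mk.injEq, h2, h3]
  rcases he with rfl | rfl <;> cases s <;> cases α <;>
    first
      | exact absurd rfl h
      | (simp only [quadTerm, evenLead, oddLead, EHat.coord, if_true, one_ne_zero, if_false,
          true_and, false_and, false_or, reduceCtorEq]; omega)

end

/-! ### Translation by periods and finite checks -/

section

/-- The translation of the affine diagram by `r` periods. -/
def EHat.shift (r : ℤ) (a : EHat) : EHat := ⟨a.weight, a.mode + r⟩

/-- The member of the incomparable pair in `Γ^{s^n}` selected by `c`. -/
def leadPair (s : G) (n : ℤ) (c : Bool) : EHat := if c then leadA s n else leadB s n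

/-- The square of the height. -/
def sqHt (a : EHat) : ℤ := a.ht ^ 2

/-- The sum of the squared heights of `a` and of the incomparable pair in `Γ^{s^n}`. -/
def tripleWt (s : G) (n : ℤ) (a : EHat) : ℤ := sqHt a + (sqHt (leadA s n) + sqHt (leadB s n))

/-- The sum of the heights of `a` and of the incomparable pair in `Γ^{s^n}`. -/
def tripleHt (s : G) (n : ℤ) (a : EHat) : ℤ := a.ht + ((leadA s n).ht + (leadB s n).ht)

theorem EHat.ht_shift (r : ℤ) (a : EHat) : (a.shift r).ht = a.ht + 8 * r := by
  simp only [EHat.shift, EHat.ht]; ring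

theorem leadPair_add (s : G) (n r : ℤ) (c : Bool) :
    leadPair s (n + 2 * r) c = (leadPair s n c).shift r := by
  have h1 : (n + 2 * r) / 2 = n / 2 + r := by omega
  have h2 : (n + 2 * r) % 2 = n % 2 := by omega
  cases c
  · simp only [leadPair, leadB, EHat.shift, h1, h2, Bool.false_eq_true, if_false,
      EHat.mk.injEq, true_and]
    ring
  · simp only [leadPair, leadA, EHat.shift, h1, h2, if_true]

theorem leadPair_mode (s : G) (n : ℤ) (c : Bool) :
    (leadPair s n c).mode = n / 2 ∨ (leadPair s n c).mode = n - n / 2 := by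
  cases c
  · exact Or.inr rfl
  · exact Or.inl rfl

theorem leadPair_mode_add (s : G) (n : ℤ) (c : Bool) :
    (leadPair s n c).mode + (leadPair s n !c).mode = n := by
  cases c
  · change n - n / 2 + n / 2 = n; ring
  · change n / 2 + (n - n / 2) = n; ring

theorem tripleWt_add (s : G) (n r r' : ℤ) (a : EHat) :
    tripleWt s (n + 2 * r) (a.shift r') =
      sqHt (a.shift r') + (sqHt ((leadA s n).shift r) + sqHt ((leadB s n).shift r)) := by
  rw [tripleWt]
  exact congrArg₂ (fun u v => _ + (sqHt u + sqHt v)) (leadPair_add s n r true)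
    (leadPair_add s n r false)

/-- After translation the first vertex has mode 0. Incomparability then confines t to this list,
because `EHat.coord` takes values in [0, 7] × [0, 3]. -/
theorem exists_lead_base : ∀ α ∈ weightList, ∀ β ∈ weightList, ∀ t ∈ [-2, -1, 0, 1, (2 : ℤ)],
    (EHat.x ⟨α, 0⟩ < EHat.x ⟨β, t⟩ ∧ EHat.y ⟨β, t⟩ < EHat.y ⟨α, 0⟩) →
    ∃ s ∈ vectorList, ∃ c ∈ [true, false],
      leadPair s t c = ⟨α, 0⟩ ∧ leadPair s t (!c) = ⟨β, t⟩ := by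
  decide +kernel

theorem lead_unique_base : ∀ s ∈ vectorList, ∀ s' ∈ vectorList, ∀ n ∈ [0, (1 : ℤ)],
    ∀ c ∈ [true, false], leadPair s n true = leadPair s' n c →
      leadPair s n false = leadPair s' n (!c) → s = s' := by
  decide +kernel

/-- Buchberger's condition up to translation: when two incomparable pairs share a vertex, one linear
syzygy contains both quadrics, their leading terms cancel in it, and all its other terms have
greater weight. Equality of the total heights makes the comparison of weights translation invariant,
by `tripleWt_shift`. The bound 4900 = 70² is there to settle the modes l outside [-9, 9]. -/
theorem overlap_base : ∀ s ∈ vectorList, ∀ s' ∈ vectorList, ∀ n ∈ [0, (1 : ℤ)],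
    ∀ n' ∈ [-1, 0, 1, 2, (3 : ℤ)], ∀ c ∈ [true, false], ∀ c' ∈ [true, false],
    leadPair s n c = leadPair s' n' c' → leadPair s n (!c) ≠ leadPair s' n' (!c') →
    ∃ γ ∈ weightList,
      (syzTerm γ (leadPair s' n' (!c')).weight).2 = s ∧
      (syzTerm γ (leadPair s n (!c)).weight).2 = s' ∧
      (syzTerm γ (leadPair s' n' (!c')).weight).1 *
        (syzTerm γ (leadPair s' n' (!c')).weight).1 = 1 ∧
      (syzTerm γ (leadPair s' n' (!c')).weight).1 * leadSign s n +
        (syzTerm γ (leadPair s n (!c)).weight).1 * leadSign s' n' = 0 ∧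
      n + (leadPair s' n' (!c')).mode = n' + (leadPair s n (!c)).mode ∧
      tripleWt s n (leadPair s' n' (!c')) < 4900 ∧
      ∀ α ∈ weightList, (syzTerm γ α).1 ≠ 0 →
        tripleHt (syzTerm γ α).2 (n + (leadPair s' n' (!c')).mode) ⟨α, 0⟩ =
          tripleHt s n (leadPair s' n' (!c')) ∧
        ∀ l ∈ [-9, -8, -7, -6, -5, -4, -3, -2, -1, 0, 1, 2, 3, 4, 5, 6, 7, 8, (9 : ℤ)],
          (⟨α, l⟩ : EHat) = leadPair s' n' (!c') ∨ (⟨α, l⟩ : EHat) = leadPair s n (!c) ∨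
          tripleWt s n (leadPair s' n' (!c')) <
            tripleWt (syzTerm γ α).2 (n + (leadPair s' n' (!c')).mode - l) ⟨α, l⟩ := by
  decide +kernel

end

/-! ### Overlaps of incomparable pairs at arbitrary modes -/

section

theorem EHat.shift_injective (r : ℤ) : Function.Injective (EHat.shift r) := by
  intro a b h
  simp only [EHat.shift, EHat.mk.injEq, add_left_inj] at h
  exact EHat.ext h.1 h.2

theorem EHat.ht_weight (α : E) : 0 ≤ α.ht ∧ α.ht ≤ 10 := by cases α <;> decide

theorem sqHt_shift (r : ℤ) (a : EHat) : sqHt (a.shift r) = sqHt a + 16 * r * a.ht + 64 * r ^ 2 := by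
  rw [sqHt, sqHt, EHat.ht_shift]; ring

theorem tripleWt_shift (s : G) (n r : ℤ) (a : EHat) : tripleWt s (n + 2 * r) (a.shift r) =
    tripleWt s n a + 16 * r * tripleHt s n a + 192 * r ^ 2 := by
  rw [tripleWt_add, sqHt_shift, sqHt_shift, sqHt_shift, tripleWt, tripleHt]; ring

theorem tripleHt_sub (s : G) (n l : ℤ) (α : E) :
    tripleHt s (n - l) ⟨α, l⟩ = tripleHt s n ⟨α, 0⟩ := by
  have key : ∀ n, (leadA s n).ht + (leadB s n).ht = (leadA s 0).ht + (leadB s 0).ht + 8 * n := by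
    intro n
    rcases Int.emod_two_eq_zero_or_one n with h | h <;>
      simp only [leadA, leadB, EHat.ht, h] <;> cases s <;>
      simp [evenLead, oddLead, E.ht] <;> omega
  rw [tripleHt, tripleHt, key, key n]
  simp only [EHat.ht]
  ring

theorem exists_lead {a b : EHat} (hx : a.x < b.x) (hy : b.y < a.y) :
    ∃ s n c, leadPair s n c = a ∧ leadPair s n (!c) = b := by
  obtain ⟨α, r⟩ := a
  obtain ⟨β, q⟩ := b
  have h0 : EHat.x ⟨α, 0⟩ < EHat.x ⟨β, q - r⟩ ∧ EHat.y ⟨β, q - r⟩ < EHat.y ⟨α, 0⟩ := by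
    simp only [EHat.x, EHat.y] at hx hy ⊢; omega
  have hmem : q - r ∈ [-2, -1, 0, 1, (2 : ℤ)] := by
    have hb : ∀ α, 0 ≤ (EHat.coord α).1 ∧ (EHat.coord α).1 ≤ 7 ∧ 0 ≤ (EHat.coord α).2 ∧
      (EHat.coord α).2 ≤ 3 := by intro α; cases α <;> decide
    have h1 := hb α
    have h2 := hb β
    simp only [EHat.x, EHat.y] at h0
    simp only [List.mem_cons, List.not_mem_nil, or_false]
    omega
  obtain ⟨s, -, c, -, h1, h2⟩ :=
    exists_lead_base α (mem_weightList α) β (mem_weightList β) (q - r) hmem h0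
  refine ⟨s, q - r + 2 * r, c, ?_, ?_⟩
  · rw [leadPair_add, h1]; simp [EHat.shift]
  · rw [leadPair_add, h2]; simp [EHat.shift]

theorem mem_bool_list (c : Bool) : c ∈ [true, false] := by cases c <;> decide

theorem emod_two_mem (n : ℤ) : n - 2 * (n / 2) ∈ [0, (1 : ℤ)] := by
  simp only [List.mem_cons, List.not_mem_nil, or_false]; omega

theorem leadPair_eq_shift (s : G) (n k : ℤ) (c : Bool) :
    leadPair s n c = (leadPair s (n - 2 * k) c).shift k := by
  rw [← leadPair_add, sub_add_cancel]

theorem lead_unique {s s' : G} {n n' : ℤ} {c : Bool} (h : leadPair s n true = leadPair s' n' c)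
    (h' : leadPair s n false = leadPair s' n' (!c)) : s = s' ∧ n = n' := by
  have hn : n = n' := by
    have h1 := leadPair_mode_add s n true
    rw [Bool.not_true, h, h', leadPair_mode_add] at h1
    exact h1.symm
  subst hn
  rw [leadPair_eq_shift s n (n / 2), leadPair_eq_shift s' n (n / 2)] at h h'
  exact ⟨lead_unique_base s (mem_vectorList s) s' (mem_vectorList s') _ (emod_two_mem n) c
    (mem_bool_list c) (EHat.shift_injective _ h) (EHat.shift_injective _ h'), rfl⟩

/-- Translation by n / 2 periods brings n into {0, 1}; the shared vertex p then confines n' to [-1,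
3], the range of `overlap_base`. -/
theorem exists_overlap {s s' : G} {n n' : ℤ} {c c' : Bool} {p q r : EHat}
    (hp : leadPair s n c = p) (hq : leadPair s n (!c) = q) (hp' : leadPair s' n' c' = p)
    (hr : leadPair s' n' (!c') = r) (hqr : q ≠ r) :
    ∃ γ, (syzTerm γ r.weight).2 = s ∧ (syzTerm γ q.weight).2 = s' ∧
      (syzTerm γ r.weight).1 * (syzTerm γ r.weight).1 = 1 ∧
      (syzTerm γ r.weight).1 * leadSign s n + (syzTerm γ q.weight).1 * leadSign s' n' = 0 ∧
      n + r.mode = n' + q.mode ∧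
      ∀ a : EHat, (syzTerm γ a.weight).1 ≠ 0 → a ≠ r → a ≠ q →
        tripleWt s n r < tripleWt (syzTerm γ a.weight).2 (n + r.mode - a.mode) a := by
  have hpp : leadPair s (n - 2 * (n / 2)) c = leadPair s' (n' - 2 * (n / 2)) c' := by
    apply EHat.shift_injective (n / 2)
    rw [← leadPair_eq_shift, ← leadPair_eq_shift, hp, hp']
  have hqr' : leadPair s (n - 2 * (n / 2)) (!c) ≠ leadPair s' (n' - 2 * (n / 2)) (!c') := by
    intro h
    rw [leadPair_eq_shift s n (n / 2), h, ← leadPair_eq_shift] at hq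
    exact hqr (hq.symm.trans hr)
  have hmem : n' - 2 * (n / 2) ∈ [-1, 0, 1, 2, (3 : ℤ)] := by
    have h1 := leadPair_mode s (n - 2 * (n / 2)) c
    rw [hpp] at h1
    have h2 := leadPair_mode s' (n' - 2 * (n / 2)) c'
    simp only [List.mem_cons, List.not_mem_nil, or_false]
    omega
  obtain ⟨γ, -, h1, h2, h3, h4, h5, h6, h7⟩ := overlap_base s (mem_vectorList s) s'
    (mem_vectorList s') _ (emod_two_mem n) _ hmem c (mem_bool_list c) c' (mem_bool_list c') hpp hqr'
  have hq0 := leadPair_eq_shift s n (n / 2) (!c)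
  have hr0 := leadPair_eq_shift s' n' (n / 2) (!c')
  rw [hq] at hq0
  rw [hr] at hr0
  have hsgn : ∀ s n k, leadSign s (n - 2 * k) = leadSign s n := by
    intro s n k
    have := leadPair_eq_shift s n k true
    change leadA s n = (leadA s (n - 2 * k)).shift k at this
    rw [leadSign, leadSign, this, EHat.shift]
  rw [hsgn, hsgn] at h4
  generalize hk : n / 2 = k at *
  generalize leadPair s (n - 2 * k) (!c) = q' at *
  generalize leadPair s' (n' - 2 * k) (!c') = r' at *
  subst hq0 hr0
  refine ⟨γ, h1, h2, h3, h4, ?_, ?_⟩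
  · simp only [EHat.shift]; omega
  intro a ha har haq
  obtain ⟨h8, h9⟩ := h7 a.weight (mem_weightList _) ha
  have e1 := tripleWt_shift s (n - 2 * k) k r'
  rw [sub_add_cancel] at e1
  have e2 := tripleWt_shift (syzTerm γ a.weight).2 (n - 2 * k + r'.mode - (a.mode - k)) k
    ⟨a.weight, a.mode - k⟩
  have e3 : EHat.shift k ⟨a.weight, a.mode - k⟩ = a := by simp [EHat.shift]
  have e4 : n - 2 * k + r'.mode - (a.mode - k) + 2 * k = n + (r'.shift k).mode - a.mode := by
    simp only [EHat.shift]; ring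
  rw [e3, e4, tripleHt_sub, h8] at e2
  rw [e1, e2]
  have key : tripleWt s (n - 2 * k) r' < tripleWt (syzTerm γ a.weight).2
      (n - 2 * k + r'.mode - (a.mode - k)) ⟨a.weight, a.mode - k⟩ := by
    by_cases hl : -9 ≤ a.mode - k ∧ a.mode - k ≤ 9
    · have hl' : a.mode - k ∈ [-9, -8, -7, -6, -5, -4, -3, -2, -1, 0, 1, 2, 3, 4, 5, 6, 7, 8,
          (9 : ℤ)] := by
        simp only [List.mem_cons, List.not_mem_nil, or_false]; omega
      rcases h9 _ hl' with h | h | h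
      · exact absurd (by rw [← h, e3]) har
      · exact absurd (by rw [← h, e3]) haq
      · exact h
    · refine h6.trans_le ?_
      have hb := EHat.ht_weight a.weight
      rw [tripleWt]
      -- Heights of weights lie in [0, 10], so a mode of at least 10 gives height at least 80, and a
      -- mode of at most -10 gives height at most -70.
      have h10 : 4900 ≤ sqHt ⟨a.weight, a.mode - k⟩ := by
        simp only [sqHt, EHat.ht]
        rcases not_and_or.mp hl with h | h
        · nlinarith
        · nlinarith
      have h11 : ∀ b, 0 ≤ sqHt b := fun b => sq_nonneg _
      have := h11 (leadA (syzTerm γ a.weight).2 (n - 2 * k + r'.mode - (a.mode - k)))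
      have := h11 (leadB (syzTerm γ a.weight).2 (n - 2 * k + r'.mode - (a.mode - k)))
      omega
  omega

end

/-! ### Coefficients in z of the quadrics and of their syzygies -/

section

open MvPolynomial

variable (d d' : EHat)

open Classical in
/-- The generator `λ^a`, or zero when `a` does not lie in the segment. -/
noncomputable def genX (a : EHat) : Poly d d' := if h : a ∈ Set.Icc d d' then X ⟨a, h⟩ else 0

variable {d d'}

theorem coeff_C_mul_T_mul {R : Type*} [CommRing R] (r : R) (m n : ℤ) (f : LaurentPolynomial R) :
    (LaurentPolynomial.C r * LaurentPolynomial.T m * f).coeff n = r * f.coeff (n - m) := by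
  rw [← LaurentPolynomial.single_eq_C_mul_T]
  exact AddMonoidAlgebra.coeff_single_mul_eq_mul_coeff _ fun _ _ => by omega

theorem coeff_genFun_mul (α : E) (f : LaurentPolynomial (Poly d d')) (n : ℤ) :
    (genFun d d' α * f).coeff n =
      ∑ a : Set.Icc d d', if a.1.weight = α then X a * f.coeff (n - a.1.mode) else 0 := by
  classical
  rw [genFun, Finset.sum_mul]
  rw [AddMonoidAlgebra.coeff_sum, Finsupp.finsetSum_apply]
  refine Finset.sum_congr rfl fun a _ => ?_
  split_ifs
  · rw [coeff_C_mul_T_mul]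
  · rw [zero_mul]; rfl

theorem coeff_genFun (α : E) (n : ℤ) : (genFun d d' α).coeff n = genX d d' ⟨α, n⟩ := by
  classical
  have h := coeff_genFun_mul (d := d) (d' := d') α 1 n
  rw [mul_one] at h
  rw [h, genX]
  have h1 : ∀ m : ℤ, (1 : LaurentPolynomial (Poly d d')).coeff m = if m = 0 then 1 else 0 := by
    intro m
    rw [← map_one LaurentPolynomial.C, LaurentPolynomial.C_apply]
  simp only [h1]
  split_ifs with hmem
  · rw [Finset.sum_eq_single ⟨⟨α, n⟩, hmem⟩]
    · simp
    · rintro ⟨⟨β, l⟩, hb⟩ - hne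
      split_ifs with h2 h3
      · exact absurd (Subtype.ext (EHat.ext h2 (by simp only at h3 ⊢; omega))) hne
      · simp
      · rfl
    · simp
  · refine Finset.sum_eq_zero ?_
    rintro ⟨⟨β, l⟩, hb⟩ -
    split_ifs with h2 h3
    · obtain rfl : β = α := h2
      obtain rfl : n = l := by simp only at h3; omega
      exact absurd hb hmem
    · simp
    · rfl

theorem coeff_sum_genFun_mul (c : E → ℤ) (f : E → LaurentPolynomial (Poly d d')) (n : ℤ) :
    (∑ α, (c α : LaurentPolynomial (Poly d d')) * (genFun d d' α * f α)).coeff n =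
      ∑ a : Set.Icc d d', (c a.1.weight : Poly d d') *
        (X a * (f a.1.weight).coeff (n - a.1.mode)) := by
  classical
  have h1 : ∀ (k : ℤ) (g : LaurentPolynomial (Poly d d')),
      ((k : LaurentPolynomial (Poly d d')) * g).coeff n = (k : Poly d d') * g.coeff n := by
    intro k g
    rw [← zsmul_eq_mul, ← zsmul_eq_mul]
    rfl
  rw [AddMonoidAlgebra.coeff_sum, Finsupp.finsetSum_apply]
  simp only [h1, coeff_genFun_mul, Finset.mul_sum]
  rw [Finset.sum_comm]
  refine Finset.sum_congr rfl fun a _ => ?_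
  simp

theorem relation_eq_sum (s : G) (n : ℤ) : relation d d' s n =
    ∑ a : Set.Icc d d', ((quadTerm s a.1.weight).1 : Poly d d') *
      (X a * genX d d' (partner s n a.1)) := by
  rw [relation, Gam_eq_sum,
    coeff_sum_genFun_mul (fun α => (quadTerm s α).1) (fun α => genFun d d' (quadTerm s α).2)]
  simp only [coeff_genFun, partner]

/-- The syzygies hold for every family in a commutative ring, hence for the generating functions
truncated to a segment. -/
theorem sum_syzTerm_relation (γ : E) (n : ℤ) :
    ∑ a : Set.Icc d d', ((syzTerm γ a.1.weight).1 : Poly d d') *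
      (X a * relation d d' (syzTerm γ a.1.weight).2 (n - a.1.mode)) = 0 := by
  have h := coeff_sum_genFun_mul (d := d) (d' := d') (fun α => (syzTerm γ α).1)
    (fun α => Gam (genFun d d') (syzTerm γ α).2) n
  rw [sum_syzTerm] at h
  exact h.symm

end

/-! ### The relations form a resolving family; standard monomials -/

section

open MvPolynomial

/-- The pairs `(s, n)` for which the incomparable pair of `Γ^{s^n}` lies in the segment. -/
abbrev RelIndex (d d' : EHat) : Type :=
  {i : G × ℤ // leadA i.1 i.2 ∈ Set.Icc d d' ∧ leadB i.1 i.2 ∈ Set.Icc d d'}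

namespace RelIndex

variable {d d' : EHat}

/-- The first member of the incomparable pair. -/
def fst (i : RelIndex d d') : Set.Icc d d' := ⟨_, i.2.1⟩

/-- The second member of the incomparable pair. -/
def snd (i : RelIndex d d') : Set.Icc d d' := ⟨_, i.2.2⟩

/-- The relation, normalized so that the product of the incomparable pair has coefficient `1`. -/
noncomputable def rel (i : RelIndex d d') : Poly d d' :=
  (leadSign i.1.1 i.1.2 : Poly d d') * relation d d' i.1.1 i.1.2

end RelIndex

variable (d d' : EHat)

/-- The weight of a generator. -/
def segWt (a : Set.Icc d d') : ℤ := sqHt a.1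

variable {d d'}

theorem leadSign_mul_self_cast (s : G) (n : ℤ) :
    (leadSign s n : Poly d d') * (leadSign s n : Poly d d') = 1 := by
  rw [← Int.cast_mul, leadSign_mul_self, Int.cast_one]

theorem RelIndex.relation_eq (i : RelIndex d d') :
    relation d d' i.1.1 i.1.2 = (leadSign i.1.1 i.1.2 : Poly d d') * i.rel := by
  rw [RelIndex.rel, ← mul_assoc, leadSign_mul_self_cast, one_mul]

theorem genX_of_mem {a : EHat} (h : a ∈ Set.Icc d d') : genX d d' a = X ⟨a, h⟩ := dif_pos h

theorem mem_of_genX_ne_zero {a : EHat} (h : genX d d' a ≠ 0) : a ∈ Set.Icc d d' := by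
  by_contra hn
  exact h (dif_neg hn)

/-- A surviving product has factors bracketing the incomparable pair in both coordinates, and a
segment is convex there. Truncation thus either removes a quadric altogether or keeps its leading
term. -/
theorem relation_eq_zero {s : G} {n : ℤ}
    (h : ¬ (leadA s n ∈ Set.Icc d d' ∧ leadB s n ∈ Set.Icc d d')) : relation d d' s n = 0 := by
  rw [relation_eq_sum]
  refine Finset.sum_eq_zero fun a _ => ?_
  by_cases hc : (quadTerm s a.1.weight).1 = 0
  · rw [hc, Int.cast_zero, zero_mul]
  by_cases hg : genX d d' (partner s n a.1) = 0
  · rw [hg, mul_zero, mul_zero]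
  have hp := mem_of_genX_ne_zero hg
  have ha := a.2
  refine absurd ?_ h
  rcases coord_bracket s n a.1 hc with ⟨hx, hy, rfl' | hb | hb⟩
  · rw [rfl', partner_leadA] at hp
    exact ⟨rfl' ▸ ha, hp⟩
  all_goals
    rw [Set.mem_Icc, EHat.le_iff, EHat.le_iff] at ha hp
    rw [Set.mem_Icc, Set.mem_Icc, EHat.le_iff, EHat.le_iff, EHat.le_iff, EHat.le_iff]
    omega

/-- For heights u, v of the incomparable pair and t, u + v - t of the other one, t² + (u + v - t)² -
u² - v² = 2(t - u)(t - v), which is positive because t lies beyond both u and v. -/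
theorem sqHt_lt_of_bracket {s : G} {n : ℤ} {a : EHat} (h : (quadTerm s a.weight).1 ≠ 0)
    (ha : a ≠ leadA s n) :
    sqHt (leadA s n) + sqHt (leadB s n) < sqHt a + sqHt (partner s n a) := by
  have hl := leadA_leadB_coord s n
  obtain ⟨hx, hy, hb⟩ := coord_bracket s n a h
  have hb := hb.resolve_left ha
  simp only [sqHt, EHat.ht_eq]
  generalize (leadA s n).x = x1 at *
  generalize (leadA s n).y = y1 at *
  generalize (leadB s n).x = x2 at *
  generalize (leadB s n).y = y2 at *
  obtain ⟨u, hu⟩ : ∃ u, u = x1 + y1 := ⟨_, rfl⟩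
  obtain ⟨v, hv⟩ : ∃ v, v = x2 + y2 := ⟨_, rfl⟩
  obtain ⟨t, ht⟩ : ∃ t, t = a.x + a.y := ⟨_, rfl⟩
  have hs : (partner s n a).x + (partner s n a).y = u + v - t := by omega
  rw [hs, ← hu, ← hv, ← ht]
  have h1 : 0 < (t - u) * (t - v) := by
    rcases hb with hb | hb
    · exact mul_pos_of_neg_of_neg (by omega) (by omega)
    · exact mul_pos (by omega) (by omega)
  nlinarith

theorem RelIndex.tail_mem (i : RelIndex d d') : i.rel - X i.fst * X i.snd ∈
    weightGE ℂ (segWt d d') (segWt d d' i.fst + segWt d d' i.snd + 1) := by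
  classical
  have h1 : i.rel - X i.fst * X i.snd = (leadSign i.1.1 i.1.2 : Poly d d') *
      ∑ a ∈ Finset.univ.erase i.fst, ((quadTerm i.1.1 a.1.weight).1 : Poly d d') *
        (X a * genX d d' (partner i.1.1 i.1.2 a.1)) := by
    rw [RelIndex.rel, relation_eq_sum, ← Finset.add_sum_erase _ _ (Finset.mem_univ i.fst), mul_add]
    have h2 : genX d d' (partner i.1.1 i.1.2 i.fst.1) = X i.snd := by
      have : partner i.1.1 i.1.2 i.fst.1 = i.snd.1 := partner_leadA _ _
      rw [this, genX_of_mem i.snd.2]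
    have h3 : ((quadTerm i.1.1 i.fst.1.weight).1 : Poly d d') =
      (leadSign i.1.1 i.1.2 : Poly d d') := rfl
    rw [h2, h3, ← mul_assoc, leadSign_mul_self_cast, one_mul, add_sub_cancel_left]
  rw [h1, ← zsmul_eq_mul]
  refine zsmul_mem (sum_mem fun a ha => ?_) _
  rw [Finset.mem_erase] at ha
  by_cases hc : (quadTerm i.1.1 a.1.weight).1 = 0
  · rw [hc, Int.cast_zero, zero_mul]; exact zero_mem _
  by_cases hg : genX d d' (partner i.1.1 i.1.2 a.1) = 0
  · rw [hg, mul_zero, mul_zero]; exact zero_mem _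
  rw [genX_of_mem (mem_of_genX_ne_zero hg), ← zsmul_eq_mul]
  refine zsmul_mem (mul_mem_weightGE (X_mem_weightGE a) (X_mem_weightGE _) ?_) _
  exact sqHt_lt_of_bracket hc fun h => ha.1 (Subtype.ext h)

theorem exists_leadPair_of_leadExp {i : RelIndex d d'} {p q : Set.Icc d d'}
    (h : leadExp RelIndex.fst RelIndex.snd i = Finsupp.single p 1 + Finsupp.single q 1) :
    ∃ c, leadPair i.1.1 i.1.2 c = p.1 ∧ leadPair i.1.1 i.1.2 (!c) = q.1 := by
  rw [leadExp, Finsupp.single_add_single_eq_single_add_single one_ne_zero one_ne_zero] at h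
  rcases h with h | h | h | h
  · exact ⟨true, congrArg Subtype.val h.1, congrArg Subtype.val h.2⟩
  · exact ⟨false, congrArg Subtype.val h.2.2, congrArg Subtype.val h.2.1⟩

theorem isResolving_rel :
    IsResolving (segWt d d') (RelIndex.rel (d := d) (d' := d')) RelIndex.fst RelIndex.snd where
  tail := RelIndex.tail_mem
  inj i j h := by
    obtain ⟨c, h1, h2⟩ := exists_leadPair_of_leadExp (i := j) (p := i.fst) (q := i.snd) h.symm
    obtain ⟨h3, h4⟩ := lead_unique (s := i.1.1) (n := i.1.2) h1.symm h2.symm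
    exact Subtype.ext (Prod.ext h3 h4)
  overlap i j p q r hi hj hqr := by
    classical
    obtain ⟨c, hp, hq⟩ := exists_leadPair_of_leadExp hi
    obtain ⟨c', hp', hr⟩ := exists_leadPair_of_leadExp hj
    obtain ⟨γ, h1, h2, h3, h4, h5, h6⟩ :=
      exists_overlap hp hq hp' hr fun h => hqr (Subtype.ext h)
    -- The terms a = r and a = q of this syzygy form the S-polynomial up to sign. Each remaining
    -- term has coefficient 0, vanishes by truncation, or has greater weight.
    have hsum := sum_syzTerm_relation (d := d) (d' := d') γ (i.1.2 + r.1.mode)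
    rw [← Finset.add_sum_erase _ _ (Finset.mem_univ r),
      ← Finset.add_sum_erase _ _ (Finset.mem_erase.mpr ⟨hqr, Finset.mem_univ q⟩), h1, h2,
      add_sub_cancel_right, show i.1.2 + r.1.mode - q.1.mode = j.1.2 by omega, i.relation_eq,
      j.relation_eq, ← add_assoc] at hsum
    have hwt : segWt d d' p + segWt d d' q + segWt d d' r = tripleWt i.1.1 i.1.2 r.1 := by
      simp only [segWt, tripleWt, ← hp, ← hq]
      cases c <;> simp only [leadPair, Bool.not_true, Bool.not_false, Bool.false_eq_true, if_true,
        if_false] <;> ring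
    have hrest : ∑ a ∈ (Finset.univ.erase r).erase q, ((syzTerm γ a.1.weight).1 : Poly d d') *
        (X a * relation d d' (syzTerm γ a.1.weight).2 (i.1.2 + r.1.mode - a.1.mode)) ∈
        multSpan (segWt d d') RelIndex.rel RelIndex.fst RelIndex.snd
          (segWt d d' p + segWt d d' q + segWt d d' r + 1) := by
      refine sum_mem fun a ha => ?_
      simp only [Finset.mem_erase, Finset.mem_univ, and_true] at ha
      by_cases hc : (syzTerm γ a.1.weight).1 = 0
      · rw [hc, Int.cast_zero, zero_mul]; exact zero_mem _
      by_cases hin : leadA (syzTerm γ a.1.weight).2 (i.1.2 + r.1.mode - a.1.mode) ∈ Set.Icc d d' ∧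
          leadB (syzTerm γ a.1.weight).2 (i.1.2 + r.1.mode - a.1.mode) ∈ Set.Icc d d'
      · have hlt := h6 a.1 hc (fun h => ha.2 (Subtype.ext h)) (fun h => ha.1 (Subtype.ext h))
        have hrel := RelIndex.relation_eq ⟨((syzTerm γ a.1.weight).2,
          i.1.2 + r.1.mode - a.1.mode), hin⟩
        simp only at hrel
        rw [hrel, mul_left_comm (X a), ← zsmul_eq_mul, ← zsmul_eq_mul]
        refine zsmul_mem (zsmul_mem (mul_mem_multSpan (X_mem_weightGE a) _ ?_) _) _
        rw [hwt]
        exact hlt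
      · rw [relation_eq_zero hin, mul_zero, mul_zero]; exact zero_mem _
    have hmain := (neg_mem hrest)
    rw [← eq_neg_of_add_eq_zero_left hsum] at hmain
    have h4' : ((syzTerm γ q.1.weight).1 : Poly d d') * (leadSign j.1.1 j.1.2 : Poly d d') =
        - (((syzTerm γ r.1.weight).1 : Poly d d') * (leadSign i.1.1 i.1.2 : Poly d d')) := by
      rw [← Int.cast_mul, ← Int.cast_mul, ← Int.cast_neg, eq_neg_of_add_eq_zero_right h4]
    have h7 : ((syzTerm γ r.1.weight).1 : Poly d d') *
          (X r * ((leadSign i.1.1 i.1.2 : Poly d d') * i.rel)) +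
        ((syzTerm γ q.1.weight).1 : Poly d d') *
          (X q * ((leadSign j.1.1 j.1.2 : Poly d d') * j.rel)) =
        ((syzTerm γ r.1.weight).1 * leadSign i.1.1 i.1.2) • (X r * i.rel - X q * j.rel) := by
      rw [zsmul_eq_mul, Int.cast_mul]
      linear_combination (X q * j.rel) * h4'
    rw [h7] at hmain
    have h8 := zsmul_mem hmain ((syzTerm γ r.1.weight).1 * leadSign i.1.1 i.1.2)
    rwa [smul_smul, mul_mul_mul_comm, h3, leadSign_mul_self, one_mul, one_smul] at h8

theorem span_rel_eq_relIdeal :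
    Ideal.span (Set.range (RelIndex.rel (d := d) (d' := d'))) = relIdeal d d' := by
  apply le_antisymm
  · rw [Ideal.span_le]
    rintro _ ⟨i, rfl⟩
    exact Ideal.mul_mem_left _ _ (Ideal.subset_span ⟨_, _, rfl⟩)
  · rw [relIdeal, Ideal.span_le]
    rintro _ ⟨s, n, rfl⟩
    by_cases h : leadA s n ∈ Set.Icc d d' ∧ leadB s n ∈ Set.Icc d d'
    · have := RelIndex.relation_eq ⟨(s, n), h⟩
      simp only at this
      rw [SetLike.mem_coe, this]
      exact Ideal.mul_mem_left _ _ (Ideal.subset_span ⟨_, rfl⟩)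
    · rw [relation_eq_zero h]
      exact zero_mem _

/-- A monomial is standard when it is supported on a chain. -/
def IsStandard (m : Set.Icc d d' →₀ ℕ) : Prop :=
  ∀ a b, m a ≠ 0 → m b ≠ 0 → a ≤ b ∨ b ≤ a

theorem incomparable_iff {a b : EHat} : (¬ a ≤ b ∧ ¬ b ≤ a) ↔
    (a.x < b.x ∧ b.y < a.y) ∨ (b.x < a.x ∧ a.y < b.y) := by
  rw [EHat.le_iff, EHat.le_iff]; omega

theorem not_leadExp_le {m : Set.Icc d d' →₀ ℕ} (hm : IsStandard m) (i : RelIndex d d') :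
    ¬ leadExp RelIndex.fst RelIndex.snd i ≤ m := by
  classical
  intro hle
  have h1 := hle i.fst
  have h2 := hle i.snd
  simp only [leadExp, Finsupp.add_apply, Finsupp.single_apply, if_true] at h1 h2
  have h3 := hm i.fst i.snd (by omega) (by omega)
  have h4 := incomparable_iff.mpr (leadA_leadB_coord i.1.1 i.1.2)
  exact h3.elim h4.1 h4.2

/-- An element of the ideal of relations whose monomials all have weight at least `w` does not
involve standard monomials of weight `w`. -/
theorem coeff_eq_zero_of_mem_relIdeal {w : ℤ} {f : Poly d d'} (hf : f ∈ relIdeal d d')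
    (hf' : f ∈ weightGE ℂ (segWt d d') w) {m : Set.Icc d d' →₀ ℕ} (hm : IsStandard m)
    (hmw : Finsupp.weight (segWt d d') m ≤ w) : coeff m f = 0 :=
  isResolving_rel.coeff_eq_zero (by rwa [span_rel_eq_relIdeal]) hf' (not_leadExp_le hm) hmw

theorem RelIndex.isHomogeneous_rel (i : RelIndex d d') : i.rel.IsHomogeneous 2 := by
  have hX : ∀ a, (genX d d' a).IsHomogeneous 1 := by
    intro a
    rw [genX]
    split_ifs with h
    · exact isHomogeneous_X _ _
    · exact isHomogeneous_zero _ _ _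
  have hc : ∀ k : ℤ, (k : Poly d d').IsHomogeneous 0 := by
    intro k
    have := isHomogeneous_C (Set.Icc d d') (k : ℂ)
    simpa using this
  rw [RelIndex.rel, relation_eq_sum]
  have h := (hc (leadSign i.1.1 i.1.2)).mul (IsHomogeneous.sum Finset.univ
    (fun a : Set.Icc d d' => ((quadTerm i.1.1 a.1.weight).1 : Poly d d') *
      (X a * genX d d' (partner i.1.1 i.1.2 a.1))) 2
    fun a _ => by
      simpa using (hc (quadTerm i.1.1 a.1.weight).1).mul ((isHomogeneous_X ℂ a).mul (hX _)))
  simpa using h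

theorem exists_rel_of_incomparable {a b : Set.Icc d d'} (h : ¬ a ≤ b ∧ ¬ b ≤ a) :
    ∃ i : RelIndex d d', i.fst = a ∧ i.snd = b ∨ i.fst = b ∧ i.snd = a := by
  obtain ⟨s, n, c, h1, h2⟩ : ∃ s n c, leadPair s n c = a.1 ∧ leadPair s n (!c) = b.1 := by
    rcases incomparable_iff.mp h with h | h
    · exact exists_lead h.1 h.2
    · obtain ⟨s, n, c, h1, h2⟩ := exists_lead h.1 h.2
      exact ⟨s, n, !c, h2, by rwa [Bool.not_not]⟩
  cases c
  · exact ⟨⟨(s, n), by change leadPair s n true ∈ _; rw [← Bool.not_false, h2]; exact b.2,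
      by change leadPair s n false ∈ _; rw [h1]; exact a.2⟩,
      Or.inr ⟨Subtype.ext h2, Subtype.ext h1⟩⟩
  · exact ⟨⟨(s, n), by change leadPair s n true ∈ _; rw [h1]; exact a.2,
      by change leadPair s n false ∈ _; rw [← Bool.not_true, h2]; exact b.2⟩,
      Or.inl ⟨Subtype.ext h1, Subtype.ext h2⟩⟩

/-- The product of two incomparable generators is, modulo the relations, a combination of
products of greater weight. -/
theorem exists_straightening {a b : Set.Icc d d'} (h : ¬ a ≤ b ∧ ¬ b ≤ a) :
    ∃ f : Poly d d', X a * X b - f ∈ relIdeal d d' ∧ f.IsHomogeneous 2 ∧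
      f ∈ weightGE ℂ (segWt d d') (segWt d d' a + segWt d d' b + 1) := by
  obtain ⟨i, hi⟩ := exists_rel_of_incomparable h
  have hX : X i.fst * X i.snd = (X a * X b : Poly d d') := by
    rcases hi with ⟨h1, h2⟩ | ⟨h1, h2⟩
    · rw [h1, h2]
    · rw [h1, h2, mul_comm]
  have hw : segWt d d' i.fst + segWt d d' i.snd = segWt d d' a + segWt d d' b := by
    rcases hi with ⟨h1, h2⟩ | ⟨h1, h2⟩
    · rw [h1, h2]
    · rw [h1, h2, add_comm]
  refine ⟨X a * X b - i.rel, ?_, ?_, ?_⟩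
  · rw [sub_sub_cancel, ← span_rel_eq_relIdeal]
    exact Ideal.subset_span ⟨i, rfl⟩
  · exact ((isHomogeneous_X ℂ a).mul (isHomogeneous_X ℂ b)).sub i.isHomogeneous_rel
  · rw [← neg_sub, ← hX, ← hw]
    exact neg_mem i.tail_mem

end

/-! ### Admissible sets and leftmost maximal chains -/

section

/-- `b` is the left neighbour of `a` at the same height. -/
def IsLeft (b a : EHat) : Prop := b.x = a.x - 1 ∧ b.y = a.y + 1

/-- Two elements are comparable. -/
def Comp (a b : EHat) : Prop := a ≤ b ∨ b ≤ a

theorem comp_iff {a b : EHat} :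
    Comp a b ↔ (a.x ≤ b.x ∧ a.y ≤ b.y) ∨ (b.x ≤ a.x ∧ b.y ≤ a.y) := by
  rw [Comp, EHat.le_iff, EHat.le_iff]

theorem not_comp_iff {a b : EHat} :
    ¬ Comp a b ↔ (a.x < b.x ∧ b.y < a.y) ∨ (b.x < a.x ∧ a.y < b.y) := by
  rw [comp_iff]; omega

theorem IsLeft.not_comp {a b : EHat} (h : IsLeft b a) : ¬ Comp b a := by
  rw [not_comp_iff]; obtain ⟨h1, h2⟩ := h; omega

theorem IsLeft.ht_eq {a b : EHat} (h : IsLeft b a) : b.ht = a.ht := by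
  rw [EHat.ht_eq, EHat.ht_eq]; obtain ⟨h1, h2⟩ := h; omega

theorem IsLeft.unique_right {a b c : EHat} (h : IsLeft a b) (h' : IsLeft a c) : b = c := by
  obtain ⟨h1, h2⟩ := h
  obtain ⟨h3, h4⟩ := h'
  exact EHat.ext_coord (by omega) (by omega)

/-- Two steps would cross the whole strip, from x - y = 0 with x even to x - y = 4 with x odd, yet
they change x by 2. Hence at most two vertices share a height. -/
theorem IsLeft.not_isLeft {a b c : EHat} (h : IsLeft a b) : ¬ IsLeft b c := by
  rintro ⟨h3, h4⟩
  obtain ⟨h1, h2⟩ := h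
  have := EHat.coord_mem a
  have := EHat.coord_mem b
  have := EHat.coord_mem c
  omega

theorem eq_or_isLeft_of_ht_eq {a b : EHat} (h : a.ht = b.ht) : a = b ∨ IsLeft a b ∨ IsLeft b a := by
  rw [EHat.ht_eq, EHat.ht_eq] at h
  have := EHat.coord_mem a
  have := EHat.coord_mem b
  by_cases hx : a.x = b.x
  · exact Or.inl (EHat.ext_coord hx (by omega))
  · right
    simp only [IsLeft]
    omega

theorem Comp.eq_of_ht_eq {a b : EHat} (h : Comp a b) (hh : a.ht = b.ht) : a = b := by
  rw [EHat.ht_eq, EHat.ht_eq] at hh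
  rw [comp_iff] at h
  exact EHat.ext_coord (by omega) (by omega)

section Chains

variable {d d' : EHat}

/-- Comparable with all elements of `C`. -/
def Compat (C : Finset (Set.Icc d d')) (a : EHat) : Prop := ∀ c ∈ C, Comp a c.1

/-- An admissible set is a chain of elements `c` which have in the segment a left neighbour
that is comparable with all other elements of the set. -/
structure IsAdmissible (C : Finset (Set.Icc d d')) : Prop where
  chain : ∀ c ∈ C, ∀ e ∈ C, Comp c.1 e.1
  left : ∀ c ∈ C, ∃ b : Set.Icc d d', IsLeft b.1 c.1 ∧ ∀ e ∈ C, e ≠ c → Comp b.1 e.1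

/-- The element belongs to the leftmost maximal chain through `C`. -/
structure IsLeftmost (C : Finset (Set.Icc d d')) (a : Set.Icc d d') : Prop where
  compat : Compat C a.1
  left : ∀ b : Set.Icc d d', IsLeft b.1 a.1 → ¬ Compat C b.1

theorem mem_Icc_coord {a : EHat} :
    a ∈ Set.Icc d d' ↔ d.x ≤ a.x ∧ d.y ≤ a.y ∧ a.x ≤ d'.x ∧ a.y ≤ d'.y := by
  rw [Set.mem_Icc, EHat.le_iff, EHat.le_iff]; tauto

/-- If a is incomparable with some c in C, its neighbour of the same height on the side of c is in
the segment and comparable with all of C. From a compatible vertex one moves left if the left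
neighbour is compatible too. -/
theorem IsAdmissible.exists_isLeftmost {C : Finset (Set.Icc d d')} (hC : IsAdmissible C)
    (a : Set.Icc d d') : ∃ b, IsLeftmost C b ∧ b.1.ht = a.1.ht := by
  have step : ∀ a : Set.Icc d d', Compat C a.1 → ∃ b, IsLeftmost C b ∧ b.1.ht = a.1.ht := by
    intro a ha
    by_cases h : ∃ b : Set.Icc d d', IsLeft b.1 a.1 ∧ Compat C b.1
    · obtain ⟨b, hb, hbC⟩ := h
      exact ⟨b, ⟨hbC, fun c hc _ => hc.not_isLeft hb⟩, hb.ht_eq⟩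
    · exact ⟨a, ⟨ha, fun b hb hbC => h ⟨b, hb, hbC⟩⟩, rfl⟩
  by_cases ha : Compat C a.1
  · exact step a ha
  simp only [Compat, not_forall] at ha
  obtain ⟨c, hc, hac⟩ := ha
  rw [not_comp_iff] at hac
  have hac0 := hac
  have h1 := EHat.coord_mem a.1
  have h2 := EHat.coord_mem c.1
  have h3 := mem_Icc_coord.mp a.2
  have h4 := mem_Icc_coord.mp c.2
  rcases hac with ⟨hx, hy⟩ | ⟨hx, hy⟩
  · obtain ⟨b, hbx, hby⟩ := EHat.exists_coord (u := a.1.x + 1) (v := a.1.y - 1)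
      (by omega) (by omega) (by omega) (by omega)
    have hb : b ∈ Set.Icc d d' := mem_Icc_coord.mpr (by omega)
    have hbC : Compat C b := by
      intro e he
      have hce := comp_iff.mp (hC.chain c hc e he)
      rw [comp_iff, hbx, hby]
      by_contra hbe
      have h5 := EHat.coord_mem e.1
      omega
    obtain ⟨f, hf, hfb⟩ := step ⟨b, hb⟩ hbC
    refine ⟨f, hf, hfb.trans ?_⟩
    rw [EHat.ht_eq, EHat.ht_eq, hbx, hby]; ring
  · obtain ⟨b, hbx, hby⟩ := EHat.exists_coord (u := a.1.x - 1) (v := a.1.y + 1)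
      (by omega) (by omega) (by omega) (by omega)
    have hb : b ∈ Set.Icc d d' := mem_Icc_coord.mpr (by omega)
    have hbC : Compat C b := by
      intro e he
      have hce := comp_iff.mp (hC.chain c hc e he)
      rw [comp_iff, hbx, hby]
      by_contra hbe
      have h5 := EHat.coord_mem e.1
      omega
    obtain ⟨f, hf, hfb⟩ := step ⟨b, hb⟩ hbC
    refine ⟨f, hf, hfb.trans ?_⟩
    rw [EHat.ht_eq, EHat.ht_eq, hbx, hby]; ring

/-- If a were to the left of b, the left neighbour of b would lie between them, hence be compatible
with C, against the choice of b. -/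
theorem IsLeftmost.comp {C : Finset (Set.Icc d d')} {a b : Set.Icc d d'} (ha : IsLeftmost C a)
    (hb : IsLeftmost C b) : Comp a.1 b.1 := by
  have key : ∀ {a b : Set.Icc d d'}, IsLeftmost C a → IsLeftmost C b →
      ¬ (a.1.x < b.1.x ∧ b.1.y < a.1.y) := by
    rintro a b ha hb ⟨hx, hy⟩
    have h1 := EHat.coord_mem a.1
    have h2 := EHat.coord_mem b.1
    have h3 := mem_Icc_coord.mp a.2
    have h4 := mem_Icc_coord.mp b.2
    obtain ⟨e, hex, hey⟩ := EHat.exists_coord (u := b.1.x - 1) (v := b.1.y + 1)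
      (by omega) (by omega) (by omega) (by omega)
    have he : e ∈ Set.Icc d d' := mem_Icc_coord.mpr (by omega)
    refine hb.left ⟨e, he⟩ ⟨hex, hey⟩ fun c hc => ?_
    have h5 := comp_iff.mp (ha.compat c hc)
    have h6 := comp_iff.mp (hb.compat c hc)
    rw [comp_iff, hex, hey]
    omega
  by_contra h
  rcases not_comp_iff.mp h with h | h
  · exact key ha hb h
  · exact key hb ha h

theorem IsAdmissible.isLeftmost {C : Finset (Set.Icc d d')} (hC : IsAdmissible C)
    {c : Set.Icc d d'} (hc : c ∈ C) : IsLeftmost C c :=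
  ⟨hC.chain c hc, fun _ hb hbC => hb.not_comp (hbC c hc)⟩

/-- Otherwise f has a left neighbour g in the segment. It is comparable with c, and with the other
elements of C because they are comparable with f, c and the left neighbour of c. So f is not
leftmost. -/
theorem IsAdmissible.comp_left {C : Finset (Set.Icc d d')} (hC : IsAdmissible C)
    {c b f : Set.Icc d d'} (hc : c ∈ C) (hb : IsLeft b.1 c.1) (hf : IsLeftmost C f)
    (hfc : f ≠ c) : Comp b.1 f.1 := by
  have hcf := comp_iff.mp ((hC.isLeftmost hc).comp hf)
  by_contra hbf
  rw [not_comp_iff] at hbf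
  have hne : ¬ (f.1.x = c.1.x ∧ f.1.y = c.1.y) := fun h =>
    hfc (Subtype.ext (EHat.ext_coord h.1 h.2))
  obtain ⟨hbx, hby⟩ := hb
  have h1 := EHat.coord_mem b.1
  have h2 := EHat.coord_mem c.1
  have h3 := EHat.coord_mem f.1
  have h4 := mem_Icc_coord.mp b.2
  have h5 := mem_Icc_coord.mp c.2
  have h6 := mem_Icc_coord.mp f.2
  obtain ⟨g, hgx, hgy⟩ := EHat.exists_coord (u := f.1.x - 1) (v := f.1.y + 1)
    (by omega) (by omega) (by omega) (by omega)
  have hg : g ∈ Set.Icc d d' := mem_Icc_coord.mpr (by omega)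
  refine hf.left ⟨g, hg⟩ ⟨hgx, hgy⟩ fun e he => ?_
  have h7 := comp_iff.mp (hf.compat e he)
  have h8 := comp_iff.mp (hC.chain c hc e he)
  rw [comp_iff, hgx, hgy]
  by_cases hec : e = c
  · subst hec
    omega
  · obtain ⟨b', ⟨hbx', hby'⟩, hb'⟩ := hC.left c hc
    have h9 := comp_iff.mp (hb' e he hec)
    clear h1 h2 h3 h4 h5 h6 hgx hgy
    rcases h7 with h7 | h7 <;> rcases h9 with h9 | h9 <;> rcases hbf with hbf | hbf <;> omega

/-- C is recovered from its leftmost maximal chain as the set of elements that can be exchanged for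
their left neighbour, much like the restriction of a facet in a shelling. An exchangeable element
outside C would have a left neighbour compatible with C. -/
theorem IsAdmissible.mem_iff {C : Finset (Set.Icc d d')} (hC : IsAdmissible C)
    {c : Set.Icc d d'} : c ∈ C ↔ IsLeftmost C c ∧ ∃ b : Set.Icc d d', IsLeft b.1 c.1 ∧
      ∀ f, IsLeftmost C f → f ≠ c → Comp b.1 f.1 := by
  constructor
  · intro hc
    obtain ⟨b, hb, -⟩ := hC.left c hc
    exact ⟨hC.isLeftmost hc, b, hb, fun f hf hfc => hC.comp_left hc hb hf hfc⟩
  · rintro ⟨hc, b, hb, hbf⟩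
    by_contra hcC
    exact hc.left b hb fun e he => hbf e (hC.isLeftmost he) fun h => hcC (h ▸ he)

theorem IsAdmissible.ext {C C' : Finset (Set.Icc d d')} (hC : IsAdmissible C)
    (hC' : IsAdmissible C') (h : ∀ a, IsLeftmost C a ↔ IsLeftmost C' a) : C = C' := by
  ext c
  rw [hC.mem_iff, hC'.mem_iff]
  simp only [h]

end Chains

end

/-! ### Level sums, and spanning by admissible monomials -/

section

open MvPolynomial

variable {d d' : EHat}

variable (d d') in
/-- The number of levels of the segment. -/
def numLevels : ℕ := (d'.ht - d.ht + 1).toNat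

/-- The level of an element of the segment. -/
def level (a : Set.Icc d d') : Fin (numLevels d d') :=
  ⟨(a.1.ht - d.ht).toNat, by
    have h1 := ht_le a.2.1
    have h2 := ht_le a.2.2
    rw [numLevels]; omega⟩

theorem ht_level (a : Set.Icc d d') : a.1.ht = d.ht + (level a : ℕ) := by
  have h1 := ht_le a.2.1
  simp only [level]; omega

theorem level_eq_iff {a b : Set.Icc d d'} : level a = level b ↔ a.1.ht = b.1.ht := by
  rw [ht_level a, ht_level b, Fin.ext_iff]; omega

theorem exists_level_eq (h : d ≤ d') (i : Fin (numLevels d d')) :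
    ∃ a : Set.Icc d d', level a = i := by
  have hi : (i : ℕ) < (d'.ht - d.ht + 1).toNat := i.2
  obtain ⟨c, h1, h2, h3⟩ := EHat.exists_ht_eq h (n := d.ht + (i : ℕ)) (by omega) (by omega)
  refine ⟨⟨c, h1, h2⟩, Fin.ext ?_⟩
  simp only [level, h3]; omega

variable (d d') in
/-- The sum of the generators of a given level. -/
noncomputable def levelSum (i : Fin (numLevels d d')) : Poly d d' :=
  ∑ a : Set.Icc d d', if level a = i then X a else 0

theorem levelSum_of_isLeft {a b : Set.Icc d d'} (h : IsLeft a.1 b.1) :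
    levelSum d d' (level a) = X a + X b := by
  classical
  have hab : a ≠ b := by
    rintro rfl
    obtain ⟨h1, -⟩ := h
    omega
  rw [levelSum, ← Finset.sum_filter, ← Finset.sum_pair hab]
  refine Finset.sum_congr ?_ fun _ _ => rfl
  ext c
  simp only [Finset.mem_filter, Finset.mem_univ, true_and, Finset.mem_insert,
    Finset.mem_singleton]
  constructor
  · intro hc
    rcases eq_or_isLeft_of_ht_eq (level_eq_iff.mp hc) with h1 | h1 | h1
    · exact Or.inl (Subtype.ext h1)
    · exact absurd h h1.not_isLeft
    · exact Or.inr (Subtype.ext (h1.unique_right h))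
  · rintro (rfl | rfl)
    · rfl
    · exact level_eq_iff.mpr h.ht_eq.symm

theorem levelSum_of_forall_not_isLeft {a : Set.Icc d d'}
    (h : ∀ b : Set.Icc d d', ¬ IsLeft b.1 a.1) (h' : ∀ b : Set.Icc d d', ¬ IsLeft a.1 b.1) :
    levelSum d d' (level a) = X a := by
  classical
  rw [levelSum, Finset.sum_eq_single a]
  · rw [if_pos rfl]
  · intro b _ hb
    rw [if_neg]
    intro hab
    rcases eq_or_isLeft_of_ht_eq (level_eq_iff.mp hab) with h1 | h1 | h1
    · exact hb (Subtype.ext h1)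
    · exact h b h1
    · exact h' b h1
  · simp

section Spanning

variable (W : Submodule ℂ (Poly d d'))

theorem mem_of_forall_monomial_mem {N : ℕ} {v : ℤ} {f : Poly d d'} (hf : f.IsHomogeneous N)
    (hf' : f ∈ weightGE ℂ (segWt d d') v)
    (h : ∀ m : Set.Icc d d' →₀ ℕ, m.degree = N → v ≤ Finsupp.weight (segWt d d') m →
      monomial m 1 ∈ W) : f ∈ W := by
  rw [f.as_sum]
  refine sum_mem fun m hm => ?_
  rw [← mul_one (coeff m f), ← smul_eq_mul, ← smul_monomial]
  have hm := mem_support_iff.mp hm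
  refine W.smul_mem _ (h m ?_ (mem_weightGE_iff.mp hf' m hm))
  rw [Finsupp.degree_eq_weight_one]
  exact hf hm

theorem monomial_add_single (m : Set.Icc d d' →₀ ℕ) (a : Set.Icc d d') :
    (monomial (m + Finsupp.single a 1) 1 : Poly d d') = X a * monomial m 1 := by
  rw [X, monomial_mul, one_mul, add_comm]

variable {W}

theorem monomial_mem_of_not_comp (hI : ∀ f ∈ relIdeal d d', f ∈ W) {m : Set.Icc d d' →₀ ℕ}
    {a b : Set.Icc d d'} (ha : m a ≠ 0) (hb : m b ≠ 0) (hab : ¬ Comp a.1 b.1)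
    (h : ∀ m' : Set.Icc d d' →₀ ℕ, m'.degree = m.degree →
      Finsupp.weight (segWt d d') m < Finsupp.weight (segWt d d') m' → monomial m' 1 ∈ W) :
    monomial m 1 ∈ W := by
  classical
  have hne : a ≠ b := by
    rintro rfl
    exact hab (Or.inl le_rfl)
  have hle : Finsupp.single b 1 + Finsupp.single a 1 ≤ m := by
    intro c
    simp only [Finsupp.add_apply, Finsupp.single_apply]
    split_ifs with h1 h2 h2
    · exact absurd (h2.trans h1.symm) hne
    · subst h1; omega
    · subst h2; omega
    · omega
  obtain ⟨n, rfl⟩ := exists_add_of_le hle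
  obtain ⟨f, hf1, hf2, hf3⟩ := exists_straightening (a := a) (b := b) (not_or.mp hab)
  have h1 : (monomial (Finsupp.single b 1 + Finsupp.single a 1 + n) 1 : Poly d d') =
      monomial n 1 * (X a * X b - f) + monomial n 1 * f := by
    rw [← mul_add, sub_add_cancel, X, X, monomial_mul, monomial_mul, one_mul, one_mul,
      add_comm n, add_comm (Finsupp.single a 1)]
  rw [h1]
  refine W.add_mem (hI _ (Ideal.mul_mem_left _ _ hf1)) ?_
  refine mem_of_forall_monomial_mem W
    ((isHomogeneous_monomial (d := n) (n := n.degree) 1 rfl).mul hf2)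
    (mul_mem_weightGE (monomial_mem_weightGE 1 le_rfl) hf3 le_rfl) fun m' hm' hw => h m' ?_ ?_
  · rw [hm']
    simp only [map_add, Finsupp.degree_single]
    omega
  · simp only [map_add, Finsupp.weight_single, one_smul]
    omega

/-- The exponent of the product of the elements of a set. -/
noncomputable def setExp (C : Finset (Set.Icc d d')) : Set.Icc d d' →₀ ℕ :=
  Finsupp.indicator C fun _ _ => 1

open Classical in
theorem setExp_apply (C : Finset (Set.Icc d d')) (a : Set.Icc d d') :
    setExp C a = if a ∈ C then 1 else 0 := by
  rw [setExp, Finsupp.indicator_apply]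
  rfl

theorem exists_weight_le : ∃ K : ℤ, ∀ m : Set.Icc d d' →₀ ℕ,
    Finsupp.weight (segWt d d') m ≤ K * m.degree := by
  classical
  refine ⟨∑ a, segWt d d' a, fun m => ?_⟩
  rw [Finsupp.weight_apply, Finsupp.sum_fintype _ _ (by simp), Finsupp.degree_eq_sum, Nat.cast_sum,
    Finset.mul_sum]
  refine Finset.sum_le_sum fun a _ => ?_
  rw [nsmul_eq_mul, mul_comm]
  refine mul_le_mul_of_nonneg_right ?_ (Nat.cast_nonneg _)
  exact Finset.single_le_sum (f := segWt d d') (fun b _ => sq_nonneg _) (Finset.mem_univ a)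

/-- The number of factors that have a right neighbour in the segment. -/
noncomputable def leftCount (m : Set.Icc d d' →₀ ℕ) : ℕ := by
  classical
  exact Finsupp.weight
    (fun a : Set.Icc d d' => if ∃ b : Set.Icc d d', IsLeft a.1 b.1 then 1 else 0) m

/-- Induction on the degree, then upwards on the weight (bounded in a fixed degree), then on
`leftCount`. Modulo level sums times lower degree, a factor may be traded for minus its neighbour of
the same height, which keeps the weight. Incomparable factors are straightened into greater weight.
A monomial admitting no move is squarefree with admissible support. -/
theorem monomial_mem (hI : ∀ f ∈ relIdeal d d', f ∈ W)
    (hθ : ∀ i, ∀ f ∈ W, levelSum d d' i * f ∈ W)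
    (hC : ∀ C, IsAdmissible C → monomial (setExp C) 1 ∈ W) (m : Set.Icc d d' →₀ ℕ) :
    monomial m 1 ∈ W := by
  classical
  obtain ⟨K, hK⟩ := exists_weight_le (d := d) (d' := d')
  induction hN : m.degree using Nat.strong_induction_on generalizing m with
  | _ N ihN =>
  induction hv : (K * N - Finsupp.weight (segWt d d') m).toNat using Nat.strong_induction_on
    generalizing m with
  | _ v ihv =>
  have ihw : ∀ m' : Set.Icc d d' →₀ ℕ, m'.degree = N →
      Finsupp.weight (segWt d d') m < Finsupp.weight (segWt d d') m' → monomial m' 1 ∈ W := by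
    intro m' hm' hlt
    have h1 := hK m
    have h2 := hK m'
    rw [hN] at h1
    rw [hm'] at h2
    exact ihv _ (by omega) m' hm' rfl
  clear ihv hv
  have hsub : ∀ m' : Set.Icc d d' →₀ ℕ, m'.degree < N → ∀ i, levelSum d d' i * monomial m' 1 ∈ W :=
    fun m' hm' i => hθ i _ (ihN _ hm' m' rfl)
  clear ihN
  have hswap : ∀ (n : Set.Icc d d' →₀ ℕ) (a b : Set.Icc d d'), b.1.ht = a.1.ht →
      (n + Finsupp.single b 1).degree = (n + Finsupp.single a 1).degree ∧
      Finsupp.weight (segWt d d') (n + Finsupp.single b 1) =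
        Finsupp.weight (segWt d d') (n + Finsupp.single a 1) := by
    intro n a b hab
    simp [Finsupp.weight_single, segWt, sqHt, hab]
  induction hl : leftCount m using Nat.strong_induction_on generalizing m with
  | _ l ihl =>
  by_cases h1 : ∃ a : Set.Icc d d', m a ≠ 0 ∧ ∃ b : Set.Icc d d', IsLeft a.1 b.1
  · obtain ⟨a, ha, b, hab⟩ := h1
    obtain ⟨n, rfl⟩ : ∃ n, m = n + Finsupp.single a 1 :=
      ⟨m - Finsupp.single a 1, (tsub_add_cancel_of_le
        (Finsupp.single_le_iff.mpr (Nat.one_le_iff_ne_zero.mpr ha))).symm⟩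
    have h2 := hswap n a b hab.ht_eq.symm
    have h3 : (monomial (n + Finsupp.single a 1) 1 : Poly d d') =
        levelSum d d' (level a) * monomial n 1 - monomial (n + Finsupp.single b 1) 1 := by
      rw [monomial_add_single, monomial_add_single, levelSum_of_isLeft hab]; ring
    rw [h3]
    refine W.sub_mem (hsub n ?_ _) (ihl _ ?_ _ (h2.1.trans hN) ?_ rfl)
    · rw [← hN]; simp
    · rw [← hl, leftCount, leftCount]
      have hb : ¬ ∃ c : Set.Icc d d', IsLeft b.1 c.1 := fun ⟨c, hc⟩ => hab.not_isLeft hc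
      have ha' : ∃ c : Set.Icc d d', IsLeft a.1 c.1 := ⟨b, hab⟩
      simp only [map_add, Finsupp.weight_single, if_neg hb, if_pos ha', smul_zero, one_smul]
      omega
    · intro m' hm' hlt
      exact ihw m' hm' (by rwa [← h2.2])
  push Not at h1
  by_cases h2 : ∃ a : Set.Icc d d', m a ≠ 0 ∧ ∀ b : Set.Icc d d', ¬ IsLeft b.1 a.1
  · obtain ⟨a, ha, hab⟩ := h2
    have h1a := h1 a ha
    obtain ⟨n, rfl⟩ : ∃ n, m = n + Finsupp.single a 1 :=
      ⟨m - Finsupp.single a 1, (tsub_add_cancel_of_le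
        (Finsupp.single_le_iff.mpr (Nat.one_le_iff_ne_zero.mpr ha))).symm⟩
    rw [monomial_add_single, ← levelSum_of_forall_not_isLeft hab h1a]
    exact hsub n (by rw [← hN]; simp) _
  push Not at h2
  -- Trading a for b creates the incomparable factors b, e. Removing a single copy of a allows e = a
  -- when a is repeated, so this case also disposes of squares.
  by_cases h3 : ∃ a b e : Set.Icc d d', m a ≠ 0 ∧ IsLeft b.1 a.1 ∧
      (m - Finsupp.single a 1 : Set.Icc d d' →₀ ℕ) e ≠ 0 ∧ ¬ Comp b.1 e.1
  · obtain ⟨a, b, e, ha, hba, he, hbe⟩ := h3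
    obtain ⟨n, rfl⟩ : ∃ n, m = n + Finsupp.single a 1 :=
      ⟨m - Finsupp.single a 1, (tsub_add_cancel_of_le
        (Finsupp.single_le_iff.mpr (Nat.one_le_iff_ne_zero.mpr ha))).symm⟩
    rw [add_tsub_cancel_right] at he
    have h2 := hswap n a b hba.ht_eq
    have h3 : (monomial (n + Finsupp.single a 1) 1 : Poly d d') =
        levelSum d d' (level b) * monomial n 1 - monomial (n + Finsupp.single b 1) 1 := by
      rw [monomial_add_single, monomial_add_single, levelSum_of_isLeft hba]; ring
    rw [h3]
    refine W.sub_mem (hsub n (by rw [← hN]; simp) _)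
      (monomial_mem_of_not_comp hI (a := b) (b := e) (by simp) (by simp [he]) hbe ?_)
    intro m' hm' hlt
    exact ihw m' (hm'.trans (h2.1.trans hN)) (by rwa [← h2.2])
  push Not at h3
  by_cases h4 : ∃ a b : Set.Icc d d', m a ≠ 0 ∧ m b ≠ 0 ∧ ¬ Comp a.1 b.1
  · obtain ⟨a, b, ha, hb, hab⟩ := h4
    refine monomial_mem_of_not_comp hI ha hb hab fun m' hm' => ihw m' (hm'.trans hN)
  push Not at h4
  have h5 : m = setExp m.support := by
    ext a
    rw [setExp_apply]
    by_cases ha : m a = 0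
    · rw [if_neg (by simpa using ha), ha]
    · rw [if_pos (by simpa using ha)]
      obtain ⟨b, hb⟩ := h2 a ha
      by_contra hne
      refine hb.not_comp (h3 a b a ha hb ?_)
      simp only [Finsupp.tsub_apply, Finsupp.single_eq_same]
      omega
  rw [h5]
  refine hC _ ⟨fun a ha b hb => h4 a b (by simpa using ha) (by simpa using hb), fun a ha => ?_⟩
  have ha : m a ≠ 0 := by simpa using ha
  obtain ⟨b, hb⟩ := h2 a ha
  refine ⟨b, hb, fun e he hea => h3 a b e ha hb ?_⟩
  simpa [Finsupp.single_apply, hea.symm] using he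

end Spanning

end

/-! ### Level polynomials acting on monomials of maximal chains -/

section

open MvPolynomial

variable {d d' : EHat}

theorem IsAdmissible.exists_section (h : d ≤ d') {C : Finset (Set.Icc d d')}
    (hC : IsAdmissible C) : ∃ σ : Fin (numLevels d d') → Set.Icc d d',
      (∀ i, level (σ i) = i) ∧ ∀ a, IsLeftmost C a ↔ a ∈ Set.range σ := by
  have h1 : ∀ i, ∃ a : Set.Icc d d', IsLeftmost C a ∧ level a = i := by
    intro i
    obtain ⟨a, rfl⟩ := exists_level_eq h i
    obtain ⟨b, hb, hba⟩ := hC.exists_isLeftmost a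
    exact ⟨b, hb, level_eq_iff.mpr hba⟩
  choose σ hσ hσ' using h1
  refine ⟨σ, hσ', fun a => ⟨fun ha => ⟨level a, ?_⟩, ?_⟩⟩
  · exact Subtype.ext (((hσ _).comp ha).eq_of_ht_eq (level_eq_iff.mp (hσ' _)))
  · rintro ⟨i, rfl⟩
    exact hσ i

variable (d d') in
/-- The polynomial algebra on the levels of the segment. -/
abbrev LevelPoly : Type := MvPolynomial (Fin (numLevels d d')) ℂ

variable (d d') in
/-- The polynomial algebra on the levels mapping to the sums of the generators of the levels. -/
noncomputable def levelHom : LevelPoly d d' →ₐ[ℂ] Poly d d' :=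
  aeval (levelSum d d')

variable (d d') in
/-- The weight of a level. -/
def levelWt (i : Fin (numLevels d d')) : ℤ := (d.ht + (i : ℕ)) ^ 2

theorem segWt_eq_levelWt (a : Set.Icc d d') : segWt d d' a = levelWt d d' (level a) := by
  rw [segWt, sqHt, ht_level, levelWt]

theorem levelSum_mem_weightGE (i : Fin (numLevels d d')) :
    levelSum d d' i ∈ weightGE ℂ (segWt d d') (levelWt d d' i) := by
  refine sum_mem fun a _ => ?_
  split_ifs with h
  · rw [← h, ← segWt_eq_levelWt]
    exact X_mem_weightGE a
  · exact zero_mem _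

theorem levelHom_mem_weightGE {v : ℤ} {p : LevelPoly d d'}
    (hp : p ∈ weightGE ℂ (levelWt d d') v) : levelHom d d' p ∈ weightGE ℂ (segWt d d') v := by
  have key : ∀ k : Fin (numLevels d d') →₀ ℕ, levelHom d d' (monomial k 1) ∈
      weightGE ℂ (segWt d d') (Finsupp.weight (levelWt d d') k) := by
    intro k
    induction k using Finsupp.induction_linear with
    | zero =>
      rw [map_zero, monomial_zero', map_one, map_one, ← map_one C]
      exact monomial_mem_weightGE 1 (by simp)
    | add k l hk hl =>
      rw [← one_mul (1 : ℂ), ← monomial_mul, map_mul]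
      exact mul_mem_weightGE hk hl (by rw [map_add])
    | single i n =>
      induction n with
      | zero =>
        rw [Finsupp.single_zero, map_zero, monomial_zero', map_one, map_one, ← map_one C]
        exact monomial_mem_weightGE 1 (by simp)
      | succ n ih =>
        rw [Finsupp.single_add, ← one_mul (1 : ℂ), ← monomial_mul, map_mul]
        refine mul_mem_weightGE ih (v := levelWt d d' i) ?_ (by simp [Finsupp.weight_single])
        have : levelHom d d' (monomial (Finsupp.single i 1) 1) = levelSum d d' i :=
          aeval_X (levelSum d d') i
        rw [this]
        exact levelSum_mem_weightGE i
  have : weightGE ℂ (levelWt d d') v ≤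
      (weightGE ℂ (segWt d d') v).comap (levelHom d d').toLinearMap := by
    rw [weightGE, restrictSupport_eq_span, Submodule.span_le]
    rintro _ ⟨k, hk, rfl⟩
    exact weightGE_anti hk (key k)
  exact this hp

variable (d d') in
/-- The ideal generated by the products of incomparable generators. -/
noncomputable def nonstandardIdeal : Ideal (Poly d d') :=
  Ideal.span {f | ∃ a b : Set.Icc d d', ¬ Comp a.1 b.1 ∧ f = X a * X b}

theorem coeff_eq_zero_of_mem_nonstandardIdeal {f : Poly d d'} (hf : f ∈ nonstandardIdeal d d')
    {m : Set.Icc d d' →₀ ℕ} (hm : IsStandard m) : coeff m f = 0 := by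
  classical
  have hset : {f : Poly d d' | ∃ a b : Set.Icc d d', ¬ Comp a.1 b.1 ∧ f = X a * X b} =
      (fun s => monomial s (1 : ℂ)) '' {s | ∃ a b : Set.Icc d d', ¬ Comp a.1 b.1 ∧
        s = Finsupp.single a 1 + Finsupp.single b 1} := by
    ext f
    constructor
    · rintro ⟨a, b, hab, rfl⟩
      exact ⟨_, ⟨a, b, hab, rfl⟩, by simp [X, monomial_mul]⟩
    · rintro ⟨_, ⟨a, b, hab, rfl⟩, rfl⟩
      exact ⟨a, b, hab, by simp [X, monomial_mul]⟩
  rw [nonstandardIdeal, hset, mem_ideal_span_monomial_image] at hf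
  by_contra hne
  obtain ⟨_, ⟨a, b, hab, rfl⟩, hle⟩ := hf m (mem_support_iff.mpr hne)
  have h1 := hle a
  have h2 := hle b
  simp only [Finsupp.add_apply, Finsupp.single_apply, if_true] at h1 h2
  exact hab (hm a b (by omega) (by omega))

/-- Any other vertex of the level of a is incomparable with a, which already divides the monomial.
-/
theorem levelSum_mul_sub_mem {m : Set.Icc d d' →₀ ℕ} {a : Set.Icc d d'} (ha : m a ≠ 0) :
    levelSum d d' (level a) * monomial m 1 - monomial (m + Finsupp.single a 1) 1 ∈
      nonstandardIdeal d d' := by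
  classical
  rw [monomial_add_single, ← sub_mul, levelSum, ← Finset.add_sum_erase _ _ (Finset.mem_univ a),
    if_pos rfl, add_sub_cancel_left, Finset.sum_mul]
  refine sum_mem fun b hb => ?_
  rw [Finset.mem_erase] at hb
  split_ifs with hl
  · obtain ⟨n, rfl⟩ : ∃ n, m = n + Finsupp.single a 1 :=
      ⟨m - Finsupp.single a 1, (tsub_add_cancel_of_le
        (Finsupp.single_le_iff.mpr (Nat.one_le_iff_ne_zero.mpr ha))).symm⟩
    rw [monomial_add_single, ← mul_assoc]
    refine Ideal.mul_mem_right _ _ (Ideal.subset_span ⟨b, a, fun h => hb.1 ?_, rfl⟩)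
    exact Subtype.ext (h.eq_of_ht_eq (level_eq_iff.mp hl))
  · rw [zero_mul]
    exact zero_mem _

variable {σ : Fin (numLevels d d') → Set.Icc d d'}

theorem levelHom_monomial_mul_sub_mem (hσ : ∀ i, level (σ i) = i)
    (k : Fin (numLevels d d') →₀ ℕ) : ∀ m : Set.Icc d d' →₀ ℕ, (∀ i, m (σ i) ≠ 0) →
      levelHom d d' (monomial k 1) * monomial m 1 - monomial (m + k.mapDomain σ) 1 ∈
        nonstandardIdeal d d' := by
  induction k using Finsupp.induction_linear with
  | zero => intro m _; simp
  | add k l hk hl =>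
    intro m hm
    have h1 := hl m hm
    have h2 := hk (m + l.mapDomain σ) fun i => by
      have := hm i
      rw [Finsupp.add_apply]; omega
    have h3 := add_mem (Ideal.mul_mem_left _ (levelHom d d' (monomial k 1)) h1) h2
    have h4 : (monomial (k + l) 1 : LevelPoly d d') =
        monomial k 1 * monomial l 1 := by rw [monomial_mul, one_mul]
    rw [h4, map_mul, Finsupp.mapDomain_add, add_comm (k.mapDomain σ), ← add_assoc]
    convert h3 using 1
    ring
  | single i n =>
    induction n with
    | zero => intro m _; simp
    | succ n ih =>
      intro m hm
      have h1 := ih m hm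
      have h2 := levelSum_mul_sub_mem (m := m + (Finsupp.single i n).mapDomain σ) (a := σ i) (by
        have := hm i
        rw [Finsupp.add_apply]; omega)
      rw [hσ] at h2
      have h3 := add_mem (Ideal.mul_mem_left _ (levelSum d d' i) h1) h2
      have h4 : levelHom d d' (monomial (Finsupp.single i (n + 1)) 1) =
          levelSum d d' i * levelHom d d' (monomial (Finsupp.single i n) 1) := by
        rw [Finsupp.single_add, ← one_mul (1 : ℂ), ← monomial_mul, map_mul, mul_comm, one_mul]
        congr 1
        exact aeval_X _ i
      have h5 : m + (Finsupp.single i (n + 1)).mapDomain σ =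
          m + (Finsupp.single i n).mapDomain σ + Finsupp.single (σ i) 1 := by
        rw [Finsupp.single_add, Finsupp.mapDomain_add, Finsupp.mapDomain_single,
          Finsupp.mapDomain_single, add_assoc]
      rw [h4, h5]
      convert h3 using 1
      ring

/-- The exponent with value `k i + 1` at the element `σ i` of a maximal chain. -/
noncomputable def chainExp (σ : Fin (numLevels d d') → Set.Icc d d')
    (k : Fin (numLevels d d') →₀ ℕ) : Set.Icc d d' →₀ ℕ :=
  (Finsupp.equivFunOnFinite.symm fun _ => 1).mapDomain σ + k.mapDomain σ

theorem chainExp_apply (hσ : ∀ i, level (σ i) = i) (k : Fin (numLevels d d') →₀ ℕ)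
    (i : Fin (numLevels d d')) : chainExp σ k (σ i) = 1 + k i := by
  have hinj : Function.Injective σ := Function.LeftInverse.injective hσ
  rw [chainExp, Finsupp.add_apply, Finsupp.mapDomain_apply hinj, Finsupp.mapDomain_apply hinj]
  rfl

theorem chainExp_ne_zero_iff (hσ : ∀ i, level (σ i) = i) (k : Fin (numLevels d d') →₀ ℕ)
    (a : Set.Icc d d') : chainExp σ k a ≠ 0 ↔ a ∈ Set.range σ := by
  constructor
  · intro h
    by_contra hn
    rw [chainExp, Finsupp.add_apply, Finsupp.mapDomain_of_notMem_range _ _ hn,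
      Finsupp.mapDomain_of_notMem_range _ _ hn] at h
    exact h rfl
  · rintro ⟨i, rfl⟩
    rw [chainExp_apply hσ]; omega

theorem weight_mapDomain (hσ : ∀ i, level (σ i) = i) (k : Fin (numLevels d d') →₀ ℕ) :
    Finsupp.weight (segWt d d') (k.mapDomain σ) = Finsupp.weight (levelWt d d') k := by
  induction k using Finsupp.induction_linear with
  | zero => simp
  | add k l hk hl => rw [Finsupp.mapDomain_add, map_add, map_add, hk, hl]
  | single i n =>
    rw [Finsupp.mapDomain_single, Finsupp.weight_single, Finsupp.weight_single,
      segWt_eq_levelWt, hσ]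

theorem isStandard_chainExp (hσ : ∀ i, level (σ i) = i) (hc : ∀ i j, Comp (σ i).1 (σ j).1)
    (k : Fin (numLevels d d') →₀ ℕ) : IsStandard (chainExp σ k) := by
  intro a b ha hb
  rw [chainExp_ne_zero_iff hσ] at ha hb
  obtain ⟨i, rfl⟩ := ha
  obtain ⟨j, rfl⟩ := hb
  exact hc i j

theorem coeff_levelHom_mul (hσ : ∀ i, level (σ i) = i) {m : Set.Icc d d' →₀ ℕ}
    (hm : IsStandard m) (p : LevelPoly d d') :
    coeff m (levelHom d d' p * monomial (chainExp σ 0) 1) =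
      ∑ k ∈ p.support, coeff k p * coeff m (monomial (chainExp σ k) (1 : ℂ)) := by
  conv_lhs => rw [p.as_sum, map_sum, Finset.sum_mul, coeff_sum]
  refine Finset.sum_congr rfl fun k _ => ?_
  have h1 := coeff_eq_zero_of_mem_nonstandardIdeal (levelHom_monomial_mul_sub_mem hσ k
    (chainExp σ 0) fun i => (chainExp_ne_zero_iff hσ 0 _).mpr ⟨i, rfl⟩) hm
  have h2 : chainExp σ 0 + k.mapDomain σ = chainExp σ k := by
    simp [chainExp]
  rw [coeff_sub, sub_eq_zero, h2] at h1
  rw [← h1, ← coeff_C_mul]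
  congr 1
  have h3 : (monomial k (coeff k p) : LevelPoly d d') =
      C (coeff k p) * monomial k 1 := by rw [C_mul_monomial, mul_one]
  rw [h3, map_mul, mul_assoc]
  congr 1
  exact (levelHom d d').commutes _

end

/-! ### Independence and freeness over the level polynomials -/

section

open MvPolynomial

variable {d d' : EHat}

/-- Standard monomials on leftmost maximal chains are independent over the polynomial algebra on
the levels. -/
theorem eq_zero_of_sum_mem_relIdeal {ι : Type*} [Fintype ι]
    {σ : ι → Fin (numLevels d d') → Set.Icc d d'} (hσ : ∀ c i, level (σ c i) = i)
    (hc : ∀ c i j, Comp (σ c i).1 (σ c j).1)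
    (hinj : ∀ c c', Set.range (σ c) = Set.range (σ c') → c = c')
    (p : ι → LevelPoly d d')
    (hp : ∑ c, levelHom d d' (p c) * monomial (chainExp (σ c) 0) 1 ∈ relIdeal d d') : p = 0 := by
  classical
  -- Once all coefficients of smaller weight vanish, the whole sum has weight at least that of
  -- `chainExp (σ c) k`, so its coefficient at this standard monomial is 0. Distinct pairs (c, k)
  -- give distinct monomials, so that coefficient is `coeff k (p c)`.
  have key : ∀ (w : ℕ) (c : ι) (k : Fin (numLevels d d') →₀ ℕ),
      (Finsupp.weight (levelWt d d') k).toNat = w → coeff k (p c) = 0 := by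
    intro w
    induction w using Nat.strong_induction_on with
    | _ w ih =>
    intro c k hk
    have hnonneg : ∀ k : Fin (numLevels d d') →₀ ℕ, 0 ≤ Finsupp.weight (levelWt d d') k := by
      intro k
      rw [Finsupp.weight_apply]
      exact Finset.sum_nonneg fun i _ => nsmul_nonneg (sq_nonneg (d.ht + (i : ℕ))) _
    have hpw : ∀ c, p c ∈ weightGE ℂ (levelWt d d') (Finsupp.weight (levelWt d d') k) := by
      intro c'
      rw [mem_weightGE_iff]
      intro l hl
      by_contra hlt
      have h1 := hnonneg k
      have h2 := hnonneg l
      exact hl (ih _ (by omega) c' l rfl)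
    have hw : ∀ c (k : Fin (numLevels d d') →₀ ℕ), Finsupp.weight (segWt d d') (chainExp (σ c) k) =
        Finsupp.weight (levelWt d d') (Finsupp.equivFunOnFinite.symm fun _ => 1) +
          Finsupp.weight (levelWt d d') k := by
      intro c k
      rw [chainExp, map_add, weight_mapDomain (hσ c), weight_mapDomain (hσ c)]
    have hmem : ∑ c, levelHom d d' (p c) * monomial (chainExp (σ c) 0) 1 ∈
        weightGE ℂ (segWt d d') (Finsupp.weight (segWt d d') (chainExp (σ c) k)) := by
      refine sum_mem fun c' _ => ?_
      refine mul_mem_weightGE (levelHom_mem_weightGE (hpw c')) (monomial_mem_weightGE 1 le_rfl) ?_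
      rw [hw, hw, map_zero]
      omega
    have hstd := isStandard_chainExp (hσ c) (hc c) k
    have h0 := coeff_eq_zero_of_mem_relIdeal hp hmem hstd le_rfl
    have heq : ∀ c' k', chainExp (σ c') k' = chainExp (σ c) k → c' = c ∧ k' = k := by
      intro c' k' h
      obtain rfl : c' = c := by
        apply hinj
        ext a
        rw [← chainExp_ne_zero_iff (hσ c') k', ← chainExp_ne_zero_iff (hσ c) k, h]
      refine ⟨rfl, Finsupp.ext fun i => ?_⟩
      have := DFunLike.congr_fun h (σ c' i)
      rw [chainExp_apply (hσ c'), chainExp_apply (hσ c')] at this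
      omega
    rw [coeff_sum, Finset.sum_eq_single c] at h0
    · rw [coeff_levelHom_mul (hσ c) hstd, Finset.sum_eq_single k] at h0
      · simpa using h0
      · intro k' _ hne
        rw [coeff_monomial, if_neg fun h => hne (heq c k' h).2, mul_zero]
      · intro hk'
        rw [notMem_support_iff.mp hk', zero_mul]
    · intro c' _ hne
      rw [coeff_levelHom_mul (hσ c') hstd]
      refine Finset.sum_eq_zero fun k' _ => ?_
      rw [coeff_monomial, if_neg fun h => hne (heq c' k' h).1, mul_zero]
    · simp
  funext c
  ext k
  exact key _ c k rfl

theorem finite_and_free_of_surjective (h : d ≤ d') {A : Type*} [CommRing A]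
    [Algebra (LevelPoly d d') A] (mk : Poly d d' →+* A)
    (hmk : Function.Surjective mk) (hker : ∀ f, mk f = 0 ↔ f ∈ relIdeal d d')
    (halg : ∀ p, algebraMap _ A p = mk (levelHom d d' p)) :
    Module.Finite (LevelPoly d d') A ∧
      Module.Free (LevelPoly d d') A := by
  classical
  let ι := {C : Finset (Set.Icc d d') // IsAdmissible C}
  have smul_mk : ∀ (p : LevelPoly d d') (f : Poly d d'), p • mk f = mk (levelHom d d' p * f) := by
    intro p f
    rw [Algebra.smul_def, map_mul, halg]
  have hsec := fun C : ι => C.2.exists_section h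
  choose σ hσ hσ' using hsec
  let u : ι → A := fun C => mk (monomial (setExp C.1) 1)
  let v : ι → A := fun C => mk (monomial (chainExp (σ C) 0) 1)
  have hspan : Submodule.span (LevelPoly d d') (Set.range u) = ⊤ := by
    let N := Submodule.span (LevelPoly d d') (Set.range u)
    let W : Submodule ℂ (Poly d d') :=
      { carrier := {f | mk f ∈ N}
        add_mem' := fun {f g} hf hg => by
          change mk (f + g) ∈ N
          rw [map_add]
          exact add_mem hf hg
        zero_mem' := by
          change mk 0 ∈ N
          rw [map_zero]
          exact zero_mem _
        smul_mem' := fun r f hf => by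
          change mk (r • f) ∈ N
          have h1 : mk (r • f) = (C r : LevelPoly d d') • mk f := by
            rw [smul_mk, smul_eq_C_mul]
            congr 2
            exact ((levelHom d d').commutes r).symm
          rw [h1]
          exact Submodule.smul_mem _ _ hf }
    have hW : ∀ m, monomial m 1 ∈ W := by
      refine monomial_mem (fun f hf => ?_) (fun i f hf => ?_) fun C hC => ?_
      · change mk f ∈ N
        rw [(hker f).mpr hf]
        exact zero_mem _
      · change mk (levelSum d d' i * f) ∈ N
        have h1 : mk (levelSum d d' i * f) = (X i : LevelPoly d d') • mk f := by
          rw [smul_mk, levelHom, aeval_X]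
        rw [h1]
        exact Submodule.smul_mem _ _ hf
      · exact Submodule.subset_span ⟨⟨C, hC⟩, rfl⟩
    rw [eq_top_iff]
    rintro a -
    obtain ⟨f, rfl⟩ := hmk a
    change f ∈ W
    rw [f.as_sum]
    refine sum_mem fun m _ => ?_
    rw [← mul_one (coeff m f), ← smul_eq_mul, ← smul_monomial]
    exact W.smul_mem _ (hW m)
  have hfin : Module.Finite (LevelPoly d d') A :=
    ⟨⟨(Set.finite_range u).toFinset, by rw [Set.Finite.coe_toFinset, hspan]⟩⟩
  have hsurj : Function.Surjective (Fintype.linearCombination (LevelPoly d d') u) := by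
    rw [← LinearMap.range_eq_top, Fintype.range_linearCombination, hspan]
  have hinj : Function.Injective (Fintype.linearCombination (LevelPoly d d') v) := by
    rw [injective_iff_map_eq_zero]
    intro p hp
    refine eq_zero_of_sum_mem_relIdeal (σ := σ) hσ ?_ ?_ p ?_
    · intro C i j
      exact ((hσ' C _).mpr ⟨i, rfl⟩).comp ((hσ' C _).mpr ⟨j, rfl⟩)
    · intro C C' hCC
      refine Subtype.ext (C.2.ext C'.2 fun a => ?_)
      rw [hσ', hσ', hCC]
    · rw [← hker, map_sum, ← hp, Fintype.linearCombination_apply]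
      refine Finset.sum_congr rfl fun C _ => ?_
      rw [smul_mk]
  -- Independence is known for v and spanning for u. As both maps have the same finite free source,
  -- the Orzech property makes the surjection given by u injective.
  have hbij : Function.Bijective (Fintype.linearCombination (LevelPoly d d') u) :=
    ⟨OrzechProperty.injective_of_surjective_of_injective _ _ hinj hsurj, hsurj⟩
  exact ⟨hfin, Module.Free.of_equiv (LinearEquiv.ofBijective _ hbij)⟩

theorem isCohenMacaulay_richardsonAlgebra (h : d ≤ d') :
    IsCohenMacaulay (RichardsonAlgebra d d') := by
  let := ((Ideal.Quotient.mk (relIdeal d d')).comp (levelHom d d').toRingHom).toAlgebra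
  obtain ⟨hfin, hfree⟩ := finite_and_free_of_surjective h (Ideal.Quotient.mk (relIdeal d d'))
    Ideal.Quotient.mk_surjective (fun _ => Ideal.Quotient.eq_zero_iff_mem) fun _ => rfl
  exact isCohenMacaulay_of_free (n := numLevels d d') (RichardsonAlgebra d d')

end

end QuantumOGr

theorem corollaryC (d d' : QuantumOGr.EHat) (h : d ≤ d') :
    QuantumOGr.IsCohenMacaulay (QuantumOGr.RichardsonAlgebra d d') := by
  exact QuantumOGr.isCohenMacaulay_richardsonAlgebra h
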